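/- Let $\mathbb{B}_n=\{z\in\mathbb{C}^n:|z|<1\}$ ($|\cdot|$ the Euclidean norm), let $\mathbf{b}\in\mathbb{C}^n\setminus\{0\}$ and $\beta>1$, and for $z\in\mathbb{C}^n$ put $S_z=\{t\in\mathbb{C}: z+t\mathbf{b}\in\mathbb{B}_n\}$. Let $\frac{\partial F}{\partial\mathbf{b}}=\sum_{j=1}^n\frac{\partial F}{\partial z_j}b_j$, $\frac{\partial^0F}{\partial\mathbf{b}^0}=F$, and $\frac{\partial^kF}{\partial\mathbf{b}^k}=\frac{\partial}{\partial\mathbf{b}}\Big(\frac{\partial^{k-1}F}{\partial\mathbf{b}^{k-1}}\Big)$. *The class $Q_{\mathbf{b},\beta}(\mathbb{B}_n)$* consists of the continuous functions $L:\mathbb{B}_n\to(0,\infty)$ with $L(z)>\frac{\beta|\mathbf{b}|}{1-|z|}$ for all $z\in\mathbb{B}_n$ and $0<\lambda_1^{\mathbf{b}}(\eta)\le\lambda_2^{\mathbf{b}}(\eta)<\infty$ for all $\eta\in[0,\beta]$, where $\lambda_1^{\mathbf{b}}(\eta)$ and $\lambda_2^{\mathbf{b}}(\eta)$ are the infimum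 and the supremum of $$\frac{L(z+t\mathbf{b})}{L(z+t_0\mathbf{b})}\quad\text{over } z\in\mathbb{B}_n,\ t_0\in S_z,\ t\in\mathbb{C},\ |t-t_0|\le\frac{\eta}{L(z+t_0\mathbf{b})}.$$ *Bounded index.* A function $F$ analytic in $\mathbb{B}_n$ is of bounded $L$-index in the direction $\mathbf{b}$ if there is $m_0\in\mathbb{Z}_{\ge0}$ such that for all $m\in\mathbb{Z}_{\ge0}$ and $z\in\mathbb{B}_n$ $$\frac{1}{m!\,L^m(z)}\left|\frac{\partial^mF(z)}{\partial\mathbf{b}^m}\right|\le\max_{0\le k\le m_0}\frac{1}{k!\,L^k(z)}\left|\frac{\partial^kF(z)}{\partial\mathbf{b}^k}\right|.$$ *Neighbourhoods of zeros.* For $F$ analytic in $\mathbb{B}_n$, $z^0\in\mathbb{B}_n$ and $r>0$, let $G_r^{\mathbf{b}}(F,z^0)=\{z^0+t\mathbf{b}:t\in S_{z^0}\}$ if $F(z^0+t\mathbf{b})=0$ for all $t\in S_{z^0}$, and otherwise $$G_r^{\mathbf{b}}(F,z^0)=\bigcup_{a\in S_{z^0},\,F(z^0+a\mathbf{b})=0}\Big\{z^0+t\mathbf{b}:|t-a|\le\frac{r}{L(z^0+a\mathbf{b})}\Big\}$$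 (empty if there are no zeros). Let $G_r^{\mathbf{b}}(F)=\bigcup_{z^0\in\mathbb{B}_n}G_r^{\mathbf{b}}(F,z^0)$. **Theorem 13.** Let $\beta>1$, $L\in Q_{\mathbf{b},\beta}(\mathbb{B}_n)$, and let $p\ge0$ be an integer. Let $g_0,\dots,g_p,h$ be analytic in $\mathbb{B}_n$ and of bounded $L$-index in the direction $\mathbf{b}$, let $\mathbb{B}_n\setminus G_\beta^{\mathbf{b}}(g_0)\ne\emptyset$, and suppose that for every $r\in(0,\beta]$ there is $T=T(r)>0$ such that for all $z\in\mathbb{B}_n\setminus G_r^{\mathbf{b}}(g_0)$ and $j=1,\dots,p$ $$|g_j(z)|\le T\,L^j(z)\,|g_0(z)|.$$ Then every function $F$ analytic in $\mathbb{B}_n$ that satisfies $$g_0(z)\frac{\partial^pF}{\partial\mathbf{b}^p}+g_1(z)\frac{\partial^{p-1}F}{\partial\mathbf{b}^{p-1}}+\dots+g_p(z)F=h(z)\qquad(z\in\mathbb{B}_n)$$ is of bounded $L$-index in the direction $\mathbf{b}$. -/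

import Mathlib

open scoped ENNReal Nat

noncomputable section

namespace LIndex

/-- The space `ℂⁿ` with its Euclidean norm. -/
abbrev Cn (n : ℕ) : Type := EuclideanSpace ℂ (Fin n)

/-- The open unit ball `𝔹ₙ` of `ℂⁿ`. -/
abbrev unitBall (n : ℕ) : Set (Cn n) := Metric.ball 0 1

variable {n : ℕ}

/-- `S_z`, the set of parameters `t ∈ ℂ` with `z + t b ∈ 𝔹ₙ`. -/
def sliceParam (b z : Cn n) : Set ℂ := {t : ℂ | z + t • b ∈ unitBall n}

/-- The iterated directional derivative `∂ᵏF/∂bᵏ`: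
`∂⁰F/∂b⁰ = F` and `∂ᵏF/∂bᵏ = ∂/∂b (∂ᵏ⁻¹F/∂bᵏ⁻¹)`. -/
def dirDeriv (b : Cn n) : ℕ → (Cn n → ℂ) → Cn n → ℂ
  | 0, F => F
  | k + 1, F => fun z => lineDeriv ℂ (dirDeriv b k F) z b

/-- The quantity `|∂ᵏF(z)/∂bᵏ| / (k! L(z)ᵏ)`. -/
def normalizedDeriv (L : Cn n → ℝ) (b : Cn n) (F : Cn n → ℂ) (k : ℕ) (z : Cn n) : ℝ :=
  ‖dirDeriv b k F z‖ / ((k ! : ℝ) * L z ^ k)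

/-- `F` is analytic in `𝔹ₙ` and of bounded `L`-index in the direction `b`. -/
def IsOfBoundedIndex (L : Cn n → ℝ) (b : Cn n) (F : Cn n → ℂ) : Prop :=
  AnalyticOnNhd ℂ F (unitBall n) ∧
    ∃ m₀ : ℕ, ∀ m : ℕ, ∀ z ∈ unitBall n,
      normalizedDeriv L b F m z ≤
        (Finset.range (m₀ + 1)).sup' Finset.nonempty_range_add_one
          (fun k => normalizedDeriv L b F k z)

/-- `λ₁ᵇ(z, t₀, η, L) = inf { L(z + t b) / L(z + t₀ b) : |t - t₀| ≤ η / L(z + t₀ b) }`,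
as an extended nonnegative real. -/
def lambda₁At (L : Cn n → ℝ) (b : Cn n) (η : ℝ) (z : Cn n) (t₀ : ℂ) : ℝ≥0∞ :=
  ⨅ t ∈ Metric.closedBall t₀ (η / L (z + t₀ • b)),
    ENNReal.ofReal (L (z + t • b) / L (z + t₀ • b))

/-- `λ₂ᵇ(z, t₀, η, L) = sup { L(z + t b) / L(z + t₀ b) : |t - t₀| ≤ η / L(z + t₀ b) }`,
as an extended nonnegative real. -/
def lambda₂At (L : Cn n → ℝ) (b : Cn n) (η : ℝ) (z : Cn n) (t₀ : ℂ) : ℝ≥0∞ :=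
  ⨆ t ∈ Metric.closedBall t₀ (η / L (z + t₀ • b)),
    ENNReal.ofReal (L (z + t • b) / L (z + t₀ • b))

/-- `λ₁ᵇ(η, L)`, the infimum of `λ₁ᵇ(z, t₀, η, L)` over `z ∈ 𝔹ₙ`, `t₀ ∈ S_z`. -/
def lambda₁ (L : Cn n → ℝ) (b : Cn n) (η : ℝ) : ℝ≥0∞ :=
  ⨅ z ∈ unitBall n, ⨅ t₀ ∈ sliceParam b z, lambda₁At L b η z t₀

/-- `λ₂ᵇ(η, L)`, the supremum of `λ₂ᵇ(z, t₀, η, L)` over `z ∈ 𝔹ₙ`, `t₀ ∈ S_z`. -/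
def lambda₂ (L : Cn n → ℝ) (b : Cn n) (η : ℝ) : ℝ≥0∞ :=
  ⨆ z ∈ unitBall n, ⨆ t₀ ∈ sliceParam b z, lambda₂At L b η z t₀

/-- The class `Q_{b,β}(𝔹ₙ)`: positive continuous functions `L` on `𝔹ₙ` with
`L(z) > β|b| / (1 - |z|)` and `0 < λ₁ᵇ(η, L) ≤ λ₂ᵇ(η, L) < ∞` for all `η ∈ [0, β]`.
Only the values of `L` on `𝔹ₙ` matter. -/
structure ClassQ (b : Cn n) (β : ℝ) (L : Cn n → ℝ) : Prop where
  continuousOn : ContinuousOn L (unitBall n)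
  pos : ∀ z ∈ unitBall n, 0 < L z
  lower_bound : ∀ z ∈ unitBall n, β * ‖b‖ / (1 - ‖z‖) < L z
  lambda_bounds : ∀ η ∈ Set.Icc (0 : ℝ) β,
    0 < lambda₁ L b η ∧ lambda₁ L b η ≤ lambda₂ L b η ∧ lambda₂ L b η < ∞

/-- `G_rᵇ(F, z⁰)`: the whole slice through `z⁰` if `F` vanishes identically on it; otherwise the
union, over the zeros `a ∈ S_{z⁰}` of `t ↦ F(z⁰ + t b)`, of the sets
`{z⁰ + t b : |t - a| ≤ r / L(z⁰ + a b)}` (which is empty if there are no zeros). -/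
def zeroNhdSlice (L : Cn n → ℝ) (b : Cn n) (F : Cn n → ℂ) (r : ℝ) (z₀ : Cn n) : Set (Cn n) :=
  {w | ((∀ t ∈ sliceParam b z₀, F (z₀ + t • b) = 0) ∧
          ∃ t ∈ sliceParam b z₀, w = z₀ + t • b) ∨
       ((¬ ∀ t ∈ sliceParam b z₀, F (z₀ + t • b) = 0) ∧
          ∃ a ∈ sliceParam b z₀, F (z₀ + a • b) = 0 ∧
            ∃ t : ℂ, ‖t - a‖ ≤ r / L (z₀ + a • b) ∧ w = z₀ + t • b)}

/-- `G_rᵇ(F)`, the union of the sets `G_rᵇ(F, z⁰)` over `z⁰ ∈ 𝔹ₙ`. -/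
def zeroNhd (L : Cn n → ℝ) (b : Cn n) (F : Cn n → ℂ) (r : ℝ) : Set (Cn n) :=
  ⋃ z₀ ∈ unitBall n, zeroNhdSlice L b F r z₀

end LIndex

end

noncomputable section

/- Restrict `F` to the complex line through `z` in direction `b` and measure the parameter in
units of `1 / L z`. Bounded index then says that the Taylor coefficients of every restriction are
dominated by its first `N + 1` coefficients, with `N` independent of `z`. Such functions have
boundedly many zeros in the disc of radius `β` and, away from their zeros, a bounded logarithmic
derivative.

Dividing the equation by `g₀` therefore gives, outside boundedly many discs of small radius `ε`, a
monic linear equation for the restriction of `F` with bounded coefficients, whose right-hand side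
has a bounded logarithmic derivative. Hence the jet of `F` together with that right-hand side
satisfies a linear differential inequality. By pigeonhole, some circle of radius greater than `1`
and some vertical segment leading to it from the disc of radius `1 / 2` avoid the exceptional
discs, and by Gronwall's inequality `F` on the circle is bounded by its maximum over the disc. By
Cauchy's estimates the Taylor coefficients decay geometrically relative to that maximum, so the
first ones dominate. This covers the base points with `g₀ z ≠ 0`; these are dense, and the
inequality extends to the whole ball by continuity. -/

namespace LIndex

open Metric Set Filter Topology

section OneVariable

variable {f : ℂ → ℂ} {N : ℕ}

/-- The absolute value of the `k`-th Taylor coefficient of `f` at the origin. -/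
def taylorNorm (f : ℂ → ℂ) (k : ℕ) : ℝ := ‖iteratedDeriv k f 0‖ / (k ! : ℝ)

/-- The Taylor coefficients of `f` at the origin are dominated in absolute value by one of the
coefficients of order at most `N`. This is the condition of bounded index at a single point, for a
function whose variable has been scaled so that `L = 1` there. -/
def HasIndexLE (N : ℕ) (f : ℂ → ℂ) : Prop := ∃ k ≤ N, ∀ m, taylorNorm f m ≤ taylorNorm f k

lemma taylorNorm_nonneg (f : ℂ → ℂ) (k : ℕ) : 0 ≤ taylorNorm f k := by
  unfold taylorNorm; positivity

lemma taylorNorm_zero (f : ℂ → ℂ) : taylorNorm f 0 = ‖f 0‖ := by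
  simp [taylorNorm]

lemma taylorNorm_le_div_pow {ρ C : ℝ} (hρ : 0 < ρ) (hf : DiffContOnCl ℂ f (ball 0 ρ))
    (hC : ∀ s ∈ sphere (0 : ℂ) ρ, ‖f s‖ ≤ C) (k : ℕ) : taylorNorm f k ≤ C / ρ ^ k := by
  rw [taylorNorm, div_le_iff₀ (by positivity), div_mul_eq_mul_div, mul_comm C]
  exact Complex.norm_iteratedDeriv_le_of_forall_mem_sphere_norm_le k hρ hf hC

lemma norm_le_sum_add_of_taylorNorm_le (hf : DifferentiableOn ℂ f (ball 0 1)) {μ : ℝ}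
    (hμ : ∀ k, taylorNorm f k ≤ μ) {s : ℂ} (hs : ‖s‖ ≤ 1 / 2) (m : ℕ) :
    ‖f s‖ ≤ ∑ k ∈ Finset.range m, taylorNorm f k * (1 / 2) ^ k + 2 * μ * (1 / 2) ^ m := by
  have hterm (k : ℕ) :
      ‖(k ! : ℂ)⁻¹ • (s - 0) ^ k • iteratedDeriv k f 0‖ ≤ taylorNorm f k * (1 / 2) ^ k := by
    have : ‖(k ! : ℂ)⁻¹ • (s - 0) ^ k • iteratedDeriv k f 0‖ = taylorNorm f k * ‖s‖ ^ k := by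
      simp only [taylorNorm, sub_zero, norm_smul, norm_inv, norm_pow, RCLike.norm_natCast]
      field_simp
    rw [this]
    have := taylorNorm_nonneg f k
    gcongr
  have hsum := Complex.hasSum_taylorSeries_on_ball hf
    (z := s) (by rw [mem_ball_zero_iff]; linarith)
  have hgeom : HasSum (fun j : ℕ => μ * (1 / 2) ^ m * (1 / 2) ^ j) (μ * (1 / 2) ^ m * 2) :=
    hasSum_geometric_two.mul_left _
  have htail := ((hasSum_nat_add_iff' m).2 hsum).norm_le_of_bounded hgeom fun j => by
    calc _ ≤ taylorNorm f (j + m) * (1 / 2) ^ (j + m) := hterm _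
      _ ≤ μ * (1 / 2) ^ (j + m) := by gcongr; exact hμ _
      _ = μ * (1 / 2) ^ m * (1 / 2) ^ j := by rw [pow_add]; ring
  have hhead := norm_sum_le_of_le (Finset.range m) fun k _ => hterm k
  linarith [norm_le_norm_add_norm_sub' (f s)
    (∑ k ∈ Finset.range m, (k ! : ℂ)⁻¹ • (s - 0) ^ k • iteratedDeriv k f 0)]

lemma norm_le_two_mul_of_taylorNorm_le (hf : DifferentiableOn ℂ f (ball 0 1)) {μ : ℝ}
    (hμ : ∀ k, taylorNorm f k ≤ μ) {s : ℂ} (hs : ‖s‖ ≤ 1 / 2) : ‖f s‖ ≤ 2 * μ := by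
  simpa using norm_le_sum_add_of_taylorNorm_le hf hμ hs 0

lemma norm_le_mul_pow_card_of_zeros {ρ R : ℝ} (hρR : ρ < R) (A : Finset ℂ) {M : ℝ}
    (hf : DifferentiableOn ℂ f (ball 0 R)) (hM : ∀ s ∈ ball (0 : ℂ) R, ‖f s‖ ≤ M)
    (hA : ∀ a ∈ A, ‖a‖ ≤ ρ ∧ f a = 0) {s : ℂ} (hs : ‖s‖ ≤ ρ) :
    ‖f s‖ ≤ M * (2 * ρ / (R - ρ)) ^ A.card := by
  classical
  induction A using Finset.induction_on generalizing f M with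
  | empty => simpa using hM s (mem_ball_zero_iff.2 (hs.trans_lt hρR))
  | insert a A ha ih =>
    obtain ⟨haρ, hfa⟩ := hA a (Finset.mem_insert_self a A)
    have hmem : a ∈ ball (0 : ℂ) R := mem_ball_zero_iff.2 (haρ.trans_lt hρR)
    have hsub : ball a (R - ρ) ⊆ ball (0 : ℂ) R :=
      ball_subset_ball' (by rw [dist_zero_right]; linarith)
    have hd : DifferentiableOn ℂ (dslope f a) (ball 0 R) :=
      (Complex.differentiableOn_dslope (isOpen_ball.mem_nhds hmem)).2 hf
    have hbound : ∀ w ∈ ball (0 : ℂ) R, ‖dslope f a w‖ ≤ M / (R - ρ) := by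
      intro w hw
      by_cases hwa : w ∈ ball a (R - ρ)
      · refine Complex.norm_dslope_le_div_of_mapsTo_ball (hf.mono hsub) (fun v hv => ?_) hwa
        rw [hfa, mem_closedBall_zero_iff]
        exact hM v (hsub hv)
      · rw [mem_ball, not_lt, dist_eq_norm] at hwa
        have hne : w ≠ a := fun h => by
          rw [h, sub_self, norm_zero] at hwa
          linarith
        rw [dslope_of_ne _ hne, slope_def_field, hfa, sub_zero, norm_div]
        exact div_le_div₀ ((norm_nonneg _).trans (hM w hw)) (hM w hw) (by linarith) hwa
    have hzeros : ∀ c ∈ A, ‖c‖ ≤ ρ ∧ dslope f a c = 0 := fun c hc => by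
      obtain ⟨hcρ, hfc⟩ := hA c (Finset.mem_insert_of_mem hc)
      refine ⟨hcρ, ?_⟩
      rw [dslope_of_ne _ (ne_of_mem_of_not_mem hc ha), slope_def_field, hfa, hfc, sub_zero,
        zero_div]
    have hfs : f s = (s - a) * dslope f a s := by
      simpa only [smul_eq_mul, hfa, sub_zero] using (sub_smul_dslope f a s).symm
    have hsa : ‖s - a‖ ≤ 2 * ρ := (norm_sub_le _ _).trans (by linarith)
    calc ‖f s‖ = ‖s - a‖ * ‖dslope f a s‖ := by rw [hfs, norm_mul]
      _ ≤ 2 * ρ * (M / (R - ρ) * (2 * ρ / (R - ρ)) ^ A.card) :=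
          mul_le_mul hsa (ih hd hbound hzeros) (norm_nonneg _) ((norm_nonneg _).trans hsa)
      _ = M * (2 * ρ / (R - ρ)) ^ (insert a A).card := by
          rw [Finset.card_insert_of_notMem ha, pow_succ]; ring

lemma encard_le_of_forall_finset {α : Type*} {Z : Set α} {N : ℕ}
    (h : ∀ A : Finset α, ↑A ⊆ Z → A.card ≤ N) : Z.encard ≤ N := by
  by_contra! hlt
  obtain ⟨A, hAZ, hA⟩ := exists_subset_encard_eq (Order.add_one_le_of_lt hlt)
  obtain ⟨A, rfl⟩ := (finite_of_encard_eq_coe (k := N + 1) hA).exists_finset_coe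
  have hcard := h A hAZ
  rw [encard_coe_eq_coe_finsetCard] at hA
  have : A.card = N + 1 := by exact_mod_cast hA
  omega

lemma HasIndexLE.encard_zeros_le (h : HasIndexLE N f) (hf : DifferentiableOn ℂ f (ball 0 1))
    (hf0 : ∃ k, taylorNorm f k ≠ 0) :
    {s ∈ closedBall (0 : ℂ) (1 / 10) | f s = 0}.encard ≤ (4 * N + 1 : ℕ) := by
  obtain ⟨k, hkN, hmax⟩ := h
  obtain ⟨j, hj⟩ := hf0
  set μ := taylorNorm f k
  have hμ : 0 < μ := ((taylorNorm_nonneg f j).lt_of_ne' hj).trans_le (hmax j)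
  refine encard_le_of_forall_finset fun A hA => ?_
  have hsmall : ∀ s ∈ sphere (0 : ℂ) (1 / 10), ‖f s‖ ≤ 2 * μ * (1 / 2) ^ A.card := fun s hs => by
    have := norm_le_mul_pow_card_of_zeros (ρ := 1 / 10) (R := 1 / 2) (by norm_num) A
      (hf.mono (ball_subset_ball (by norm_num)))
      (fun s hs => norm_le_two_mul_of_taylorNorm_le hf hmax (mem_ball_zero_iff.1 hs).le)
      (fun a ha => ⟨mem_closedBall_zero_iff.1 (hA ha).1, (hA ha).2⟩)
      (mem_sphere_zero_iff_norm.1 hs).le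
    norm_num at this ⊢
    exact this
  have hcauchy : μ ≤ 2 * μ * (1 / 2) ^ A.card / (1 / 10) ^ k :=
    taylorNorm_le_div_pow (by norm_num)
      (hf.diffContOnCl_ball (closedBall_subset_ball (by norm_num))) hsmall k
  have hpow : (2 : ℝ) ^ A.card ≤ 2 ^ (4 * N + 1) := by
    have h10 : (10 : ℝ) ^ k ≤ (2 ^ 4) ^ N :=
      (pow_le_pow_left₀ (by norm_num) (by norm_num) k).trans
        (pow_le_pow_right₀ (by norm_num) hkN)
    refine le_of_mul_le_mul_left ?_ hμ
    calc μ * 2 ^ A.card ≤ 2 * μ * (1 / 2) ^ A.card / (1 / 10) ^ k * 2 ^ A.card := by gcongr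
      _ = 2 * μ * 10 ^ k := by simp only [one_div, inv_pow]; field_simp
      _ ≤ 2 * μ * (2 ^ 4) ^ N := by gcongr
      _ = μ * 2 ^ (4 * N + 1) := by rw [pow_succ _ (4 * N), pow_mul]; ring
  exact (pow_le_pow_iff_right₀ one_lt_two).1 hpow

lemma exists_eq_mul_exp {r : ℝ} (hf : DifferentiableOn ℂ f (ball 0 r))
    (hne : ∀ s ∈ ball (0 : ℂ) r, f s ≠ 0) :
    ∃ g : ℂ → ℂ, DifferentiableOn ℂ g (ball 0 r) ∧ g 0 = 0 ∧
      ∀ s ∈ ball (0 : ℂ) r, f s = f 0 * Complex.exp (g s) := by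
  obtain ⟨g, hg0, hg⟩ :=
    ((hf.deriv isOpen_ball).div hf hne).isExactOn_ball.with_val_at (0 : ℂ) (0 : ℂ)
  refine ⟨g, fun s hs => (hg s hs).differentiableAt.differentiableWithinAt, hg0, fun s hs => ?_⟩
  have hderiv : ∀ u ∈ ball (0 : ℂ) r, HasDerivAt (fun u => f u * Complex.exp (-g u)) 0 u := by
    intro u hu
    have hfu := (hf.differentiableAt (isOpen_ball.mem_nhds hu)).hasDerivAt
    refine (hfu.fun_mul (hg u hu).fun_neg.cexp).congr_deriv ?_
    have hfu0 := hne u hu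
    simp only [Pi.div_apply]
    field_simp
    ring
  have hconst : f s * Complex.exp (-g s) = f 0 * Complex.exp (-g 0) :=
    isOpen_ball.is_const_of_deriv_eq_zero (convex_ball (0 : ℂ) r).isPreconnected
      (fun u hu => (hderiv u hu).differentiableAt.differentiableWithinAt)
      (fun u hu => (hderiv u hu).deriv) hs (mem_ball_self (pos_of_mem_ball hs))
  rw [hg0, neg_zero, Complex.exp_zero, mul_one] at hconst
  rw [← hconst, mul_assoc, ← Complex.exp_add, neg_add_cancel, Complex.exp_zero, mul_one]

-- A Harnack inequality: the Borel–Carathéodory theorem for the logarithm of `f / f 0`.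
lemma norm_pow_three_le {r M : ℝ} (hf : DifferentiableOn ℂ f (ball 0 r))
    (hne : ∀ s ∈ ball (0 : ℂ) r, f s ≠ 0) (hM : ∀ s ∈ ball (0 : ℂ) r, ‖f s‖ ≤ M) (hr : 0 < r)
    {s : ℂ} (hs : ‖s‖ ≤ r / 4) : ‖f s‖ ^ 3 ≤ M ^ 2 * ‖f 0‖ := by
  obtain ⟨g, hgd, hg0, hfg⟩ := exists_eq_mul_exp hf hne
  have hsr : s ∈ ball (0 : ℂ) r := mem_ball_zero_iff.2 (by linarith)
  have hf0 : 0 < ‖f 0‖ := norm_pos_iff.2 (hne 0 (mem_ball_self hr))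
  have hM0 : 0 < M := hf0.trans_le (hM 0 (mem_ball_self hr))
  rcases (hM 0 (mem_ball_self hr)).eq_or_lt with hMf | hMf
  · rw [hMf]
    calc ‖f s‖ ^ 3 ≤ M ^ 3 := by gcongr; exact hM s hsr
      _ = M ^ 2 * M := pow_succ M 2
  have hnorm : ∀ u ∈ ball (0 : ℂ) r, ‖f u‖ = ‖f 0‖ * Real.exp (g u).re := fun u hu => by
    rw [hfg u hu, norm_mul, Complex.norm_exp]
  set A := Real.log (M / ‖f 0‖)
  have hexpA : Real.exp A = M / ‖f 0‖ := Real.exp_log (by positivity)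
  have hA : 0 < A := Real.log_pos ((one_lt_div hf0).2 hMf)
  have hre : MapsTo g (ball 0 r) {z | z.re ≤ A} := fun u hu => by
    change (g u).re ≤ A
    rw [← Real.exp_le_exp, hexpA, le_div_iff₀' hf0, ← hnorm u hu]
    exact hM u hu
  have hg : (g s).re ≤ 2 * A / 3 := by
    refine (Complex.re_le_norm _).trans
      ((Complex.borelCaratheodory_zero hA hgd hre hr hsr hg0).trans ?_)
    rw [div_le_div_iff₀ (by linarith) (by norm_num)]
    nlinarith
  have hexp : Real.exp (g s).re ^ 3 ≤ (M / ‖f 0‖) ^ 2 := by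
    rw [← hexpA, ← Real.exp_nat_mul, ← Real.exp_nat_mul, Real.exp_le_exp]
    push_cast
    linarith
  calc ‖f s‖ ^ 3 = ‖f 0‖ ^ 3 * Real.exp (g s).re ^ 3 := by rw [hnorm s hsr, mul_pow]
    _ ≤ ‖f 0‖ ^ 3 * (M / ‖f 0‖) ^ 2 := by gcongr
    _ = M ^ 2 * ‖f 0‖ := by field_simp

lemma HasIndexLE.taylorNorm_le (h : HasIndexLE N f) (hf : DifferentiableOn ℂ f (ball 0 1)) {ρ : ℝ}
    (hρ : 0 < ρ) (hρ2 : ρ ≤ 1 / 2) (hne : ∀ s ∈ ball (0 : ℂ) ρ, f s ≠ 0) (m : ℕ) :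
    taylorNorm f m ≤ 4 * (4 / ρ) ^ (3 * N) * ‖f 0‖ := by
  obtain ⟨k, hkN, hmax⟩ := h
  refine (hmax m).trans ?_
  set μ := taylorNorm f k
  have hμ : 0 < μ := by
    refine lt_of_lt_of_le ?_ (hmax 0)
    rw [taylorNorm_zero]
    exact norm_pos_iff.2 (hne 0 (mem_ball_self hρ))
  have hcont : ContinuousOn (fun s => ‖f s‖) (sphere (0 : ℂ) (ρ / 4)) :=
    (hf.continuousOn.mono (sphere_subset_closedBall.trans
      (closedBall_subset_ball (by linarith)))).norm
  obtain ⟨s, hs, hsmax⟩ := (isCompact_sphere (0 : ℂ) (ρ / 4)).exists_isMaxOn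
    (NormedSpace.sphere_nonempty.2 (by linarith)) hcont
  have hharnack : ‖f s‖ ^ 3 ≤ (2 * μ) ^ 2 * ‖f 0‖ :=
    norm_pow_three_le (hf.mono (ball_subset_ball (by linarith))) hne
      (fun u hu => norm_le_two_mul_of_taylorNorm_le hf hmax
        ((mem_ball_zero_iff.1 hu).le.trans hρ2)) hρ (mem_sphere_zero_iff_norm.1 hs).le
  have hcauchy : μ ≤ ‖f s‖ / (ρ / 4) ^ k :=
    taylorNorm_le_div_pow (by linarith)
      (hf.diffContOnCl_ball (closedBall_subset_ball (by linarith))) (fun u hu => hsmax hu) k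
  have hpow : ((4 / ρ) ^ k) ^ 3 ≤ (4 / ρ) ^ (3 * N) := by
    rw [← pow_mul]
    exact pow_le_pow_right₀ ((one_le_div hρ).2 (by linarith)) (by omega)
  refine le_of_mul_le_mul_left ?_ (pow_pos hμ 2)
  calc μ ^ 2 * μ = μ ^ 3 := (pow_succ μ 2).symm
    _ ≤ (‖f s‖ / (ρ / 4) ^ k) ^ 3 := by gcongr
    _ = ‖f s‖ ^ 3 * ((4 / ρ) ^ k) ^ 3 := by simp only [div_pow]; field_simp
    _ ≤ (2 * μ) ^ 2 * ‖f 0‖ * (4 / ρ) ^ (3 * N) := by gcongr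
    _ = μ ^ 2 * (4 * (4 / ρ) ^ (3 * N) * ‖f 0‖) := by ring

-- `u` is meant to be a point of the disc of radius `1 / 2` where `‖f‖` is largest: a fraction of
-- `‖f u‖` must come from the first coefficients, while Cauchy's estimates on the larger circle make
-- the remaining ones a smaller fraction of it.
lemma exists_hasIndexLE_of_norm_le {B R : ℝ} (hB : 0 < B) (hR : 1 < R) :
    ∃ N : ℕ, ∀ (f : ℂ → ℂ) (R' : ℝ), R ≤ R' → DiffContOnCl ℂ f (ball 0 R') →
      ∀ u : ℂ, ‖u‖ ≤ 1 / 2 → (∀ s ∈ sphere (0 : ℂ) R', ‖f s‖ ≤ B * ‖f u‖) → HasIndexLE N f := by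
  obtain ⟨m₀, hm₀⟩ := exists_pow_lt_of_lt_one (x := 1 / (4 * B)) (by positivity)
    (one_half_lt_one : (1 / 2 : ℝ) < 1)
  obtain ⟨m₁, hm₁⟩ := pow_unbounded_of_one_lt (4 * B) hR
  refine ⟨max m₀ m₁, fun f R' hRR' hf u hu hfu => ?_⟩
  have hcauchy (m : ℕ) : taylorNorm f m ≤ B * ‖f u‖ / R ^ m :=
    (taylorNorm_le_div_pow (by linarith) hf hfu m).trans (by gcongr)
  obtain ⟨k, hk, hmax⟩ := Finset.exists_max_image (Finset.range (max m₀ m₁ + 1)) (taylorNorm f)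
    ⟨0, by simp⟩
  have hmax' (j : ℕ) (hj : j ≤ max m₀ m₁) : taylorNorm f j ≤ taylorNorm f k :=
    hmax j (Finset.mem_range.2 (by omega))
  have hhead : ∑ j ∈ Finset.range m₀, taylorNorm f j * (1 / 2) ^ j ≤ 2 * taylorNorm f k := by
    calc ∑ j ∈ Finset.range m₀, taylorNorm f j * (1 / 2) ^ j
        ≤ ∑ j ∈ Finset.range m₀, taylorNorm f k * (1 / 2) ^ j := by
          gcongr with j hj
          exact hmax' j ((Finset.mem_range.1 hj).le.trans (le_max_left _ _))
      _ ≤ 2 * taylorNorm f k := by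
          rw [← Finset.mul_sum, mul_comm 2]
          exact mul_le_mul_of_nonneg_left (sum_geometric_two_le m₀) (taylorNorm_nonneg f k)
  have htail : 2 * (B * ‖f u‖) * (1 / 2) ^ m₀ ≤ ‖f u‖ / 2 := by
    calc 2 * (B * ‖f u‖) * (1 / 2) ^ m₀ ≤ 2 * (B * ‖f u‖) * (1 / (4 * B)) := by gcongr
      _ = ‖f u‖ / 2 := by field_simp; ring
  have hfu4 : ‖f u‖ ≤ 4 * taylorNorm f k := by
    have := norm_le_sum_add_of_taylorNorm_le (μ := B * ‖f u‖)
      (hf.differentiableOn.mono (ball_subset_ball (by linarith)))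
      (fun m => (hcauchy m).trans (div_le_self (by positivity) (one_le_pow₀ hR.le))) hu m₀
    linarith
  refine ⟨k, by simpa [Nat.lt_succ_iff] using hk, fun m => ?_⟩
  rcases le_total m (max m₀ m₁) with hm | hm
  · exact hmax' m hm
  · calc taylorNorm f m ≤ B * ‖f u‖ / R ^ m := hcauchy m
      _ ≤ B * (4 * taylorNorm f k) / (4 * B) := by
          have := taylorNorm_nonneg f k
          gcongr
          exact hm₁.le.trans (pow_le_pow_right₀ hR.le ((le_max_right _ _).trans hm))
      _ = taylorNorm f k := by field_simp

end OneVariable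

section LinearInequality

variable {p : ℕ} {C : ℝ} {f ψ : ℂ → ℂ} {U : Set ℂ}

/-- The jet `(f, …, f⁽ᵖ⁻¹⁾)` of an unknown function together with an auxiliary function `ψ`, the
right-hand side of the monic equation for `f`. -/
def jet (p : ℕ) (f ψ : ℂ → ℂ) (s : ℂ) : (Fin p → ℂ) × ℂ :=
  (fun k => iteratedDeriv k f s, ψ s)

/-- The inequalities at the point `s` that hold for a solution `f` of a monic linear equation of
order `p` with right-hand side `ψ`, when its coefficients and the logarithmic derivative of `ψ` are
bounded by `C` there. -/
structure JetBound (p : ℕ) (C : ℝ) (f ψ : ℂ → ℂ) (s : ℂ) : Prop where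
  differentiableAt : DifferentiableAt ℂ ψ s
  deriv_le : ‖deriv ψ s‖ ≤ C * ‖ψ s‖
  top_le : ‖iteratedDeriv p f s‖ ≤ ‖ψ s‖ + C * ∑ k ∈ Finset.range p, ‖iteratedDeriv k f s‖
  rhs_le : ‖ψ s‖ ≤ C * ∑ k ∈ Finset.range (p + 1), ‖iteratedDeriv k f s‖

lemma norm_iteratedDeriv_le_norm_jet {k : ℕ} (hk : k < p) (f ψ : ℂ → ℂ) (s : ℂ) :
    ‖iteratedDeriv k f s‖ ≤ ‖jet p f ψ s‖ :=
  (norm_le_pi_norm (jet p f ψ s).1 ⟨k, hk⟩).trans (norm_fst_le _)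

lemma norm_le_norm_jet (p : ℕ) (f ψ : ℂ → ℂ) (s : ℂ) : ‖ψ s‖ ≤ ‖jet p f ψ s‖ :=
  norm_snd_le (jet p f ψ s)

/-- The rate of exponential growth which `JetBound p C` imposes on the jet. -/
def jetRate (p : ℕ) (C : ℝ) : ℝ := 1 + (p + 1) * C

lemma jetRate_nonneg (hC : 0 ≤ C) : 0 ≤ jetRate p C := by
  unfold jetRate; positivity

/-- The bound which `JetBound p C` imposes on the values on the circle of radius `R`, in terms of
the maximum over the disc of radius `1 / 2`: the sum comes from Cauchy's estimates at the starting
point, the exponential from Gronwall's inequality along a path of length at most `R * (1 + π)`. -/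
def circleConst (p : ℕ) (C R : ℝ) : ℝ :=
  jetRate p C * (C * ∑ k ∈ Finset.range (p + 1), (k ! : ℝ) * 4 ^ k) *
    Real.exp (jetRate p C * (R * (1 + Real.pi)))

lemma circleConst_pos (hC : 0 < C) (R : ℝ) : 0 < circleConst p C R := by
  have hrate : 0 < jetRate p C := by unfold jetRate; positivity
  have : 0 < ∑ k ∈ Finset.range (p + 1), (k ! : ℝ) * 4 ^ k :=
    Finset.sum_pos (fun k _ => by positivity) Finset.nonempty_range_add_one
  unfold circleConst; positivity

lemma circleConst_mono (hC : 0 ≤ C) : Monotone (circleConst p C) := by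
  have := jetRate_nonneg (p := p) hC
  intro R R' hR
  unfold circleConst; gcongr

lemma hasDerivAt_iteratedDeriv (hU : IsOpen U) (hf : DifferentiableOn ℂ f U) (k : ℕ) {s : ℂ}
    (hs : s ∈ U) : HasDerivAt (iteratedDeriv k f) (iteratedDeriv (k + 1) f s) s := by
  rw [iteratedDeriv_succ, iteratedDeriv_eq_iterate]
  exact ((hf.analyticAt (hU.mem_nhds hs)).iterated_deriv k).differentiableAt.hasDerivAt

namespace JetBound

lemma norm_iteratedDeriv_le {s : ℂ} (h : JetBound p C f ψ s) (hC : 0 ≤ C) {k : ℕ} (hk : k ≤ p) :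
    ‖iteratedDeriv k f s‖ ≤ jetRate p C * ‖jet p f ψ s‖ := by
  have hJ := norm_nonneg (jet p f ψ s)
  rcases hk.lt_or_eq with hk | rfl
  · refine (norm_iteratedDeriv_le_norm_jet hk f ψ s).trans (le_mul_of_one_le_left hJ ?_)
    exact le_add_of_nonneg_right (by positivity)
  · have hsum : ∑ j ∈ Finset.range k, ‖iteratedDeriv j f s‖ ≤ k * ‖jet k f ψ s‖ := by
      simpa using Finset.sum_le_card_nsmul (Finset.range k) _ _ fun j hj =>
        norm_iteratedDeriv_le_norm_jet (Finset.mem_range.1 hj) f ψ s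
    calc ‖iteratedDeriv k f s‖
        ≤ ‖ψ s‖ + C * ∑ j ∈ Finset.range k, ‖iteratedDeriv j f s‖ := h.top_le
      _ ≤ ‖jet k f ψ s‖ + C * (k * ‖jet k f ψ s‖) := by
          gcongr
          exact norm_le_norm_jet k f ψ s
      _ ≤ jetRate k C * ‖jet k f ψ s‖ := by
          unfold jetRate
          nlinarith [mul_nonneg hC hJ]

lemma norm_deriv_le {s : ℂ} (h : JetBound p C f ψ s) (hC : 0 ≤ C) :
    ‖deriv ψ s‖ ≤ jetRate p C * ‖jet p f ψ s‖ := by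
  refine h.deriv_le.trans (mul_le_mul ?_ (norm_le_norm_jet p f ψ s) (norm_nonneg _)
    (jetRate_nonneg hC))
  unfold jetRate
  nlinarith [(Nat.cast_nonneg p : (0 : ℝ) ≤ p)]

lemma norm_jet_le {s : ℂ} (h : JetBound p C f ψ s) (hC : 1 ≤ C) :
    ‖jet p f ψ s‖ ≤ C * ∑ k ∈ Finset.range (p + 1), ‖iteratedDeriv k f s‖ := by
  have hsum : 0 ≤ ∑ k ∈ Finset.range (p + 1), ‖iteratedDeriv k f s‖ := by positivity
  refine norm_prod_le_iff.2 ⟨(pi_norm_le_iff_of_nonneg (by positivity)).2 fun k => ?_, h.rhs_le⟩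
  refine le_trans ?_ (le_mul_of_one_le_left hsum hC)
  exact Finset.single_le_sum (f := fun k => ‖iteratedDeriv k f s‖) (fun _ _ => norm_nonneg _)
    (Finset.mem_range.2 (by omega))

lemma norm_jet_path_le {V : ℝ} (hC : 0 ≤ C) (hU : IsOpen U) (hf : DifferentiableOn ℂ f U)
    {γ γ' : ℝ → ℂ} (hγ : ∀ τ, HasDerivAt γ (γ' τ) τ) (hV : ∀ τ, ‖γ' τ‖ ≤ V)
    (hmem : ∀ τ ∈ Icc (0 : ℝ) 1, γ τ ∈ U) (h : ∀ τ ∈ Icc (0 : ℝ) 1, JetBound p C f ψ (γ τ)) :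
    ‖jet p f ψ (γ 1)‖ ≤ ‖jet p f ψ (γ 0)‖ * Real.exp (jetRate p C * V) := by
  have hV0 : 0 ≤ V := (norm_nonneg _).trans (hV 0)
  set J : ℝ → (Fin p → ℂ) × ℂ := fun τ => jet p f ψ (γ τ)
  set J' : ℝ → (Fin p → ℂ) × ℂ := fun τ =>
    (fun k => γ' τ • iteratedDeriv (k + 1) f (γ τ), γ' τ • deriv ψ (γ τ)) with hJ'
  have hderiv : ∀ τ ∈ Icc (0 : ℝ) 1, HasDerivAt J (J' τ) τ := fun τ hτ =>
    HasDerivAt.prodMk (hasDerivAt_pi.2 fun k : Fin p =>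
        (hasDerivAt_iteratedDeriv hU hf k (hmem τ hτ)).scomp τ (hγ τ))
      ((h τ hτ).differentiableAt.hasDerivAt.scomp τ (hγ τ))
  have hbound : ∀ τ ∈ Icc (0 : ℝ) 1, ‖J' τ‖ ≤ jetRate p C * V * ‖J τ‖ + 0 := by
    intro τ hτ
    have := jetRate_nonneg (p := p) hC
    rw [add_zero, mul_comm (jetRate p C), mul_assoc, hJ']
    refine norm_prod_le_iff.2 ⟨(pi_norm_le_iff_of_nonneg (by positivity)).2 fun k => ?_, ?_⟩
    · rw [norm_smul]
      exact mul_le_mul (hV τ) ((h τ hτ).norm_iteratedDeriv_le hC (Nat.succ_le_of_lt k.2))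
        (norm_nonneg _) hV0
    · rw [norm_smul]
      exact mul_le_mul (hV τ) ((h τ hτ).norm_deriv_le hC) (norm_nonneg _) hV0
  have hgronwall := norm_le_gronwallBound_of_norm_deriv_right_le
    (fun τ hτ => (hderiv τ hτ).continuousAt.continuousWithinAt)
    (fun τ hτ => (hderiv τ (Ico_subset_Icc_self hτ)).hasDerivWithinAt) le_rfl
    (fun τ hτ => hbound τ (Ico_subset_Icc_self hτ)) 1 ⟨zero_le_one, le_rfl⟩
  rwa [gronwallBound_ε0, sub_zero, mul_one] at hgronwall

lemma norm_jet_segment_le (hC : 0 ≤ C) (hU : IsOpen U) (hf : DifferentiableOn ℂ f U) {z w : ℂ}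
    (hzw : segment ℝ z w ⊆ U) (h : ∀ s ∈ segment ℝ z w, JetBound p C f ψ s) :
    ‖jet p f ψ w‖ ≤ ‖jet p f ψ z‖ * Real.exp (jetRate p C * ‖w - z‖) := by
  have hmem : ∀ τ ∈ Icc (0 : ℝ) 1, AffineMap.lineMap z w τ ∈ segment ℝ z w := fun τ hτ => by
    rw [segment_eq_image_lineMap]
    exact mem_image_of_mem _ hτ
  simpa using norm_jet_path_le hC hU hf (fun τ => AffineMap.hasDerivAt_lineMap) (fun _ => le_rfl)
    (fun τ hτ => hzw (hmem τ hτ)) (fun τ hτ => h _ (hmem τ hτ))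

lemma norm_jet_arc_le {R : ℝ} (hC : 0 ≤ C) (hU : IsOpen U) (hf : DifferentiableOn ℂ f U)
    (hRU : sphere 0 R ⊆ U) (h : ∀ s ∈ sphere (0 : ℂ) R, JetBound p C f ψ s) {z w : ℂ}
    (hz : z ∈ sphere (0 : ℂ) R) (hw : w ∈ sphere (0 : ℂ) R) :
    ‖jet p f ψ w‖ ≤ ‖jet p f ψ z‖ * Real.exp (jetRate p C * (R * Real.pi)) := by
  rw [mem_sphere_zero_iff_norm] at hz hw
  set θ := (w / z).arg
  have hpolar : z * Complex.exp (θ * Complex.I) = w := by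
    rcases eq_or_ne z 0 with rfl | hz0
    · rw [norm_zero] at hz
      rw [zero_mul, eq_comm, ← norm_eq_zero, hw, ← hz]
    · have hone : ‖w / z‖ = 1 := by rw [norm_div, hw, ← hz, div_self (norm_ne_zero_iff.2 hz0)]
      have hexp := Complex.norm_mul_exp_arg_mul_I (w / z)
      rw [hone, Complex.ofReal_one, one_mul] at hexp
      rw [hexp, mul_div_cancel₀ _ hz0]
  set γ : ℝ → ℂ := fun τ => z * Complex.exp (τ * (θ * Complex.I))
  have hnorm (τ : ℝ) : ‖γ τ‖ = R := by
    rw [norm_mul, ← mul_assoc, ← Complex.ofReal_mul, Complex.norm_exp_ofReal_mul_I, hz, mul_one]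
  have hderiv (τ : ℝ) : HasDerivAt γ (γ τ * (θ * Complex.I)) τ := by
    have hlin : HasDerivAt (fun τ : ℝ => (τ : ℂ) * (θ * Complex.I)) (θ * Complex.I) τ := by
      simpa using (Complex.ofRealCLM.hasDerivAt (x := τ)).mul_const (θ * Complex.I : ℂ)
    exact (hlin.cexp.const_mul z).congr_deriv (mul_assoc _ _ _).symm
  have hspeed (τ : ℝ) : ‖γ τ * (θ * Complex.I)‖ ≤ R * Real.pi := by
    rw [norm_mul, hnorm, norm_mul, Complex.norm_I, mul_one, Complex.norm_real]
    exact mul_le_mul_of_nonneg_left (Complex.abs_arg_le_pi _) (hz ▸ norm_nonneg z)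
  have hmem (τ : ℝ) : γ τ ∈ sphere (0 : ℂ) R := mem_sphere_zero_iff_norm.2 (hnorm τ)
  have hpath := norm_jet_path_le hC hU hf hderiv hspeed (fun τ _ => hRU (hmem τ))
    (fun τ _ => h _ (hmem τ))
  rwa [show γ 1 = w by simpa [γ] using hpolar, show γ 0 = z by simp [γ]] at hpath

-- The circle is reached from the real point `x` along a vertical segment.
lemma norm_jet_circle_le {x R : ℝ} (hC : 0 ≤ C) (hxR : |x| ≤ R) (hU : IsOpen U)
    (hf : DifferentiableOn ℂ f U) (hRU : closedBall 0 R ⊆ U)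
    (hvert : ∀ s ∈ closedBall (0 : ℂ) R, s.re = x → JetBound p C f ψ s)
    (hcirc : ∀ s ∈ sphere (0 : ℂ) R, JetBound p C f ψ s) {s : ℂ} (hs : s ∈ sphere (0 : ℂ) R) :
    ‖jet p f ψ s‖ ≤ ‖jet p f ψ x‖ * Real.exp (jetRate p C * (R * (1 + Real.pi))) := by
  have hR : 0 ≤ R := (abs_nonneg x).trans hxR
  have hx2 : x ^ 2 ≤ R ^ 2 := sq_le_sq' (abs_le.1 hxR).1 (abs_le.1 hxR).2
  set y := √(R ^ 2 - x ^ 2)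
  set w : ℂ := x + y * Complex.I
  have hwR : ‖w‖ = R := by
    rw [Complex.norm_add_mul_I, Real.sq_sqrt (by linarith), add_sub_cancel, Real.sqrt_sq hR]
  have hxB : (x : ℂ) ∈ closedBall (0 : ℂ) R := by simpa using hxR
  have hwB : w ∈ closedBall (0 : ℂ) R := mem_closedBall_zero_iff.2 hwR.le
  have hseg : segment ℝ (x : ℂ) w ⊆ closedBall 0 R := (convex_closedBall 0 R).segment_subset hxB hwB
  have hre : ∀ v ∈ segment ℝ (x : ℂ) w, v.re = x := by
    rintro v ⟨a, c, -, -, hac, rfl⟩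
    simp [w, ← add_mul, hac]
  have hlen : ‖w - x‖ ≤ R := by
    rw [add_sub_cancel_left, norm_mul, Complex.norm_I, mul_one, Complex.norm_real,
      Real.norm_of_nonneg (Real.sqrt_nonneg _)]
    exact Real.sqrt_le_iff.2 ⟨hR, by nlinarith [sq_nonneg x]⟩
  have hrate := jetRate_nonneg (p := p) hC
  calc ‖jet p f ψ s‖ ≤ ‖jet p f ψ w‖ * Real.exp (jetRate p C * (R * Real.pi)) :=
        norm_jet_arc_le hC hU hf (sphere_subset_closedBall.trans hRU) hcirc
          (mem_sphere_zero_iff_norm.2 hwR) hs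
    _ ≤ ‖jet p f ψ x‖ * Real.exp (jetRate p C * R) * Real.exp (jetRate p C * (R * Real.pi)) := by
        gcongr
        refine (norm_jet_segment_le hC hU hf (hseg.trans hRU)
          fun v hv => hvert v (hseg hv) (hre v hv)).trans ?_
        gcongr
    _ = ‖jet p f ψ x‖ * Real.exp (jetRate p C * (R * (1 + Real.pi))) := by
        rw [mul_assoc, ← Real.exp_add]; ring_nf

lemma norm_circle_le {x R M : ℝ} (hC : 1 ≤ C) (hx : |x| ≤ 1 / 4) (hR : 1 / 2 ≤ R)
    (hU : IsOpen U) (hf : DifferentiableOn ℂ f U) (hRU : closedBall 0 R ⊆ U)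
    (hM : ∀ v ∈ closedBall (0 : ℂ) (1 / 2), ‖f v‖ ≤ M)
    (hvert : ∀ s ∈ closedBall (0 : ℂ) R, s.re = x → JetBound p C f ψ s)
    (hcirc : ∀ s ∈ sphere (0 : ℂ) R, JetBound p C f ψ s) {s : ℂ} (hs : s ∈ sphere (0 : ℂ) R) :
    ‖f s‖ ≤ circleConst p C R * M := by
  have hC0 : 0 ≤ C := zero_le_one.trans hC
  have hdisc : closedBall (x : ℂ) (1 / 4) ⊆ closedBall 0 (1 / 2) :=
    closedBall_subset_closedBall' (by
      rw [dist_zero_right, Complex.norm_real, Real.norm_eq_abs]; linarith)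
  have hcauchy (k : ℕ) : ‖iteratedDeriv k f x‖ ≤ (k ! : ℝ) * 4 ^ k * M := by
    refine (Complex.norm_iteratedDeriv_le_of_forall_mem_sphere_norm_le k (by norm_num)
      (hf.diffContOnCl_ball (hdisc.trans ((closedBall_subset_closedBall hR).trans hRU)))
      fun v hv => hM v (hdisc (sphere_subset_closedBall hv))).trans (le_of_eq ?_)
    rw [one_div (4 : ℝ), inv_pow, div_inv_eq_mul]
    ring
  have hstart : ‖jet p f ψ x‖ ≤ C * (∑ k ∈ Finset.range (p + 1), (k ! : ℝ) * 4 ^ k) * M := by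
    have hx' : (x : ℂ) ∈ closedBall (0 : ℂ) R := by
      rw [mem_closedBall_zero_iff, Complex.norm_real, Real.norm_eq_abs]; linarith
    refine ((hvert x hx' (Complex.ofReal_re x)).norm_jet_le hC).trans ?_
    rw [mul_assoc, Finset.sum_mul]
    gcongr with k
    exact hcauchy k
  have hrate := jetRate_nonneg (p := p) hC0
  calc ‖f s‖ ≤ jetRate p C * ‖jet p f ψ s‖ := by
        simpa using (hcirc s hs).norm_iteratedDeriv_le hC0 (Nat.zero_le p)
    _ ≤ jetRate p C * (‖jet p f ψ x‖ * Real.exp (jetRate p C * (R * (1 + Real.pi)))) := by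
        gcongr
        exact norm_jet_circle_le hC0 (by linarith) hU hf hRU hvert hcirc hs
    _ ≤ jetRate p C * (C * (∑ k ∈ Finset.range (p + 1), (k ! : ℝ) * 4 ^ k) * M *
          Real.exp (jetRate p C * (R * (1 + Real.pi)))) := by gcongr
    _ = circleConst p C R * M := by unfold circleConst; ring

end JetBound

end LinearInequality

-- Pigeonhole: a point of `S` is within `ε` of at most one of the points `u + 3 ε i`.
lemma exists_mem_Icc_forall_lt_abs_sub {S : Set ℝ} {N : ℕ} (hS : S.encard ≤ N) {ε u v : ℝ}
    (hε : 0 < ε) (huv : u + 3 * ε * N ≤ v) : ∃ x ∈ Icc u v, ∀ a ∈ S, ε < |x - a| := by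
  have hIcc (i : Fin (N + 1)) : u + 3 * ε * (i : ℕ) ∈ Icc u v := by
    have hi : ((i : ℕ) : ℝ) ≤ N := by exact_mod_cast Nat.lt_succ_iff.1 i.2
    exact ⟨le_add_of_nonneg_right (by positivity), le_trans (by gcongr) huv⟩
  by_contra! hcon
  choose a haS ha using fun i : Fin (N + 1) => hcon _ (hIcc i)
  have hinj : Function.Injective a := by
    intro i j hij
    have hi := abs_le.1 (ha i)
    have hj := abs_le.1 (ha j)
    rw [← hij] at hj
    have hlt : (i : ℝ) < (j + 1 : ℕ) := by push_cast; nlinarith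
    have hgt : (j : ℝ) < (i + 1 : ℕ) := by push_cast; nlinarith
    have hlt' := Nat.cast_lt.1 hlt
    have hgt' := Nat.cast_lt.1 hgt
    exact Fin.ext (by omega)
  have hcard : ((N + 1 : ℕ) : ℕ∞) ≤ N := by
    calc ((N + 1 : ℕ) : ℕ∞) = (range a).encard := by
          rw [← image_univ, hinj.encard_image, encard_univ, ENat.card_eq_coe_fintype_card,
            Fintype.card_fin]
      _ ≤ S.encard := encard_le_encard (range_subset_iff.2 haS)
      _ ≤ N := hS
  exact absurd (Nat.cast_le.1 hcard) (by omega)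

lemma exists_vertical_line_and_circle {Z : Set ℂ} {N : ℕ} (hZ : Z.encard ≤ N) {ε δ : ℝ}
    (hε : 0 < ε) (hδ : 3 * ε * N ≤ δ) : ∃ x ∈ Icc 0 δ, ∃ R ∈ Icc (1 + δ) (1 + 2 * δ),
      (∀ s : ℂ, s.re = x → ∀ a ∈ Z, ε < ‖s - a‖) ∧
      ∀ s ∈ sphere (0 : ℂ) R, ∀ a ∈ Z, ε < ‖s - a‖ := by
  obtain ⟨x, hxI, hx⟩ := exists_mem_Icc_forall_lt_abs_sub (u := 0) (v := δ)
    ((encard_image_le Complex.re Z).trans hZ) hε (by linarith)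
  obtain ⟨R, hRI, hR⟩ := exists_mem_Icc_forall_lt_abs_sub (u := 1 + δ) (v := 1 + 2 * δ)
    ((encard_image_le norm Z).trans hZ) hε (by linarith)
  refine ⟨x, hxI, R, hRI, fun s hs a ha => (hx _ (mem_image_of_mem _ ha)).trans_le ?_,
    fun s hs a ha => (hR _ (mem_image_of_mem _ ha)).trans_le ?_⟩
  · rw [← hs, ← Complex.sub_re]
    exact Complex.abs_re_le_norm _
  · rw [← mem_sphere_zero_iff_norm.1 hs]
    exact abs_norm_sub_norm_le s a

-- The radius `ε` depends only on the number of excluded points, not on the constant `C`; in the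
-- application `C` depends on `ε`.
lemma exists_hasIndexLE_of_jetBound {β : ℝ} (hβ : 1 < β) (N : ℕ) :
    ∃ ε ∈ Ioc 0 β, ∀ (p : ℕ) (C : ℝ), 1 ≤ C → ∃ m₀ : ℕ, ∀ (f ψ : ℂ → ℂ) (Z : Set ℂ),
      DifferentiableOn ℂ f (ball 0 β) → Z.encard ≤ N →
      (∀ s : ℂ, ‖s‖ ≤ β - ε → (∀ a ∈ Z, ε < ‖s - a‖) → JetBound p C f ψ s) →
      HasIndexLE m₀ f := by
  set δ : ℝ := min (1 / 4) ((β - 1) / 3)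
  have hδ : 0 < δ := lt_min (by norm_num) (by linarith)
  have hδ4 : δ ≤ 1 / 4 := min_le_left _ _
  have hδβ : δ ≤ (β - 1) / 3 := min_le_right _ _
  set ε : ℝ := δ / (3 * (N + 1)) with hεdef
  have hε : 0 < ε := by positivity
  have hεδ : 3 * ε * N + 3 * ε = δ := by rw [hεdef]; field_simp
  have hεN : 0 ≤ 3 * ε * N := by positivity
  refine ⟨ε, ⟨hε, by linarith⟩, fun p C hC => ?_⟩
  obtain ⟨m₀, hm₀⟩ := exists_hasIndexLE_of_norm_le (R := 1 + δ)
    (circleConst_pos (p := p) (zero_lt_one.trans_le hC) β) (by linarith)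
  refine ⟨m₀, fun f ψ Z hf hZ h => ?_⟩
  obtain ⟨x, ⟨hx0, hxδ⟩, R, ⟨hR1, hR2⟩, hx, hR⟩ :=
    exists_vertical_line_and_circle (δ := δ) hZ hε (by linarith)
  have hRball : closedBall (0 : ℂ) R ⊆ ball 0 β := closedBall_subset_ball (by linarith)
  have hvert : ∀ s ∈ closedBall (0 : ℂ) R, s.re = x → JetBound p C f ψ s := fun s hs hsx =>
    h s ((mem_closedBall_zero_iff.1 hs).trans (by linarith)) (hx s hsx)
  have hcirc : ∀ s ∈ sphere (0 : ℂ) R, JetBound p C f ψ s := fun s hs =>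
    h s ((mem_sphere_zero_iff_norm.1 hs).le.trans (by linarith)) (hR s hs)
  obtain ⟨u, hu, humax⟩ := (isCompact_closedBall (0 : ℂ) (1 / 2)).exists_isMaxOn
    (nonempty_closedBall.2 (by norm_num))
    (hf.continuousOn.mono (closedBall_subset_ball (by linarith))).norm
  refine hm₀ f R hR1 (hf.diffContOnCl_ball hRball) u (mem_closedBall_zero_iff.1 hu)
    fun s hs => ?_
  calc ‖f s‖ ≤ circleConst p C R * ‖f u‖ :=
        JetBound.norm_circle_le hC (by rw [abs_of_nonneg hx0]; linarith) (by linarith) isOpen_ball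
          hf hRball (fun v hv => humax hv) hvert hcirc hs
    _ ≤ circleConst p C β * ‖f u‖ := by
        gcongr
        exact circleConst_mono (zero_le_one.trans hC) (by linarith)

section Slices

variable {n : ℕ} {b z : Cn n} {L : Cn n → ℝ} {F : Cn n → ℂ}

lemma analyticOnNhd_dirDeriv (hF : AnalyticOnNhd ℂ F (unitBall n)) (k : ℕ) :
    AnalyticOnNhd ℂ (dirDeriv b k F) (unitBall n) := by
  induction k with
  | zero => exact hF
  | succ k ih =>
    exact ((ContinuousLinearMap.apply ℂ ℂ b).comp_analyticOnNhd ih.fderiv).congr isOpen_ball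
      fun z hz => (ih z hz).differentiableAt.lineDeriv_eq_fderiv.symm

/-- The point of the complex line through `z` in direction `b` with parameter `s` in the unit of
length `1 / L z`. -/
def slicePoint (L : Cn n → ℝ) (b z : Cn n) (s : ℂ) : Cn n := z + (s / (L z : ℂ)) • b

/-- The restriction of `F` to the complex line through `z` in direction `b`, rescaled by `L z`: its
Taylor coefficients at `0` are the normalized directional derivatives of `F` at `z`. -/
def slice (L : Cn n → ℝ) (b : Cn n) (F : Cn n → ℂ) (z : Cn n) (s : ℂ) : ℂ :=
  F (slicePoint L b z s)

/-- The set of rescaled parameters at which the line through `z` is inside the ball. -/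
def sliceDomain (L : Cn n → ℝ) (b z : Cn n) : Set ℂ := slicePoint L b z ⁻¹' unitBall n

lemma slicePoint_zero (L : Cn n → ℝ) (b z : Cn n) : slicePoint L b z 0 = z := by
  simp [slicePoint]

lemma slice_zero (L : Cn n → ℝ) (b : Cn n) (F : Cn n → ℂ) (z : Cn n) : slice L b F z 0 = F z := by
  rw [slice, slicePoint_zero]

lemma slicePoint_mul (b : Cn n) (hz : L z ≠ 0) (t : ℂ) :
    slicePoint L b z (t * L z) = z + t • b := by
  rw [slicePoint, mul_div_cancel_right₀ _ (Complex.ofReal_ne_zero.2 hz)]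

lemma slicePoint_slicePoint (b : Cn n) (hz : L z ≠ 0) (s σ : ℂ) :
    slicePoint L b (slicePoint L b z s) σ =
      slicePoint L b z (s + σ * (L z / L (slicePoint L b z s) : ℝ)) := by
  have hz' : (L z : ℂ) ≠ 0 := Complex.ofReal_ne_zero.2 hz
  nth_rewrite 1 [slicePoint]
  rw [slicePoint.eq_1 L b z s, slicePoint, add_assoc, ← add_smul]
  congr 2
  push_cast
  field_simp

lemma zero_mem_sliceDomain (hz : z ∈ unitBall n) : 0 ∈ sliceDomain L b z := by
  rwa [sliceDomain, mem_preimage, slicePoint_zero]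

lemma isOpen_sliceDomain (L : Cn n → ℝ) (b z : Cn n) : IsOpen (sliceDomain L b z) :=
  isOpen_ball.preimage (by unfold slicePoint; fun_prop)

lemma convex_sliceDomain (L : Cn n → ℝ) (b z : Cn n) : Convex ℝ (sliceDomain L b z) := by
  have hconv := ((convex_ball (0 : Cn n) 1).translate_preimage_right z).linear_preimage
    (((LinearMap.toSpanSingleton ℂ (Cn n) b).comp
      (LinearMap.mulRight ℂ (L z : ℂ)⁻¹)).restrictScalars ℝ)
  simpa [preimage, sliceDomain, slicePoint, div_eq_mul_inv] using hconv

lemma hasDerivAt_dirDeriv_slice (hF : AnalyticOnNhd ℂ F (unitBall n)) (k : ℕ) {s : ℂ}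
    (hs : s ∈ sliceDomain L b z) :
    HasDerivAt (slice L b (dirDeriv b k F) z) (slice L b (dirDeriv b (k + 1) F) z s / L z) s := by
  have hd := (analyticOnNhd_dirDeriv (b := b) hF k _ hs).differentiableAt
  have hline : HasDerivAt (slicePoint L b z) ((1 / (L z : ℂ)) • b) s :=
    (((hasDerivAt_id s).div_const (L z : ℂ)).smul_const b).const_add z
  refine (hd.hasFDerivAt.comp_hasDerivAt s hline).congr_deriv ?_
  rw [map_smul, ← hd.lineDeriv_eq_fderiv, smul_eq_mul, one_div_mul_eq_div]
  rfl

lemma iteratedDeriv_slice (hF : AnalyticOnNhd ℂ F (unitBall n)) (k : ℕ) {s : ℂ}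
    (hs : s ∈ sliceDomain L b z) :
    iteratedDeriv k (slice L b F z) s = slice L b (dirDeriv b k F) z s / (L z : ℂ) ^ k := by
  induction k generalizing s with
  | zero => simp [dirDeriv]
  | succ k ih =>
    have hev : iteratedDeriv k (slice L b F z) =ᶠ[𝓝 s]
        fun s => slice L b (dirDeriv b k F) z s / (L z : ℂ) ^ k := by
      filter_upwards [(isOpen_sliceDomain L b z).mem_nhds hs] with u hu using ih hu
    rw [iteratedDeriv_succ, hev.deriv_eq, ((hasDerivAt_dirDeriv_slice hF k hs).div_const _).deriv,
      pow_succ', div_div]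

lemma differentiableOn_slice (hF : AnalyticOnNhd ℂ F (unitBall n)) :
    DifferentiableOn ℂ (slice L b F z) (sliceDomain L b z) := fun _ hs =>
  (hasDerivAt_dirDeriv_slice hF 0 hs).differentiableAt.differentiableWithinAt

lemma taylorNorm_slice (hF : AnalyticOnNhd ℂ F (unitBall n)) (hz : z ∈ unitBall n) (hL : 0 ≤ L z)
    (k : ℕ) : taylorNorm (slice L b F z) k = normalizedDeriv L b F k z := by
  rw [taylorNorm, iteratedDeriv_slice hF k (zero_mem_sliceDomain hz), slice_zero, normalizedDeriv,
    norm_div, norm_pow, Complex.norm_real, Real.norm_of_nonneg hL, div_div, mul_comm]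

lemma exists_taylorNorm_slice_ne_zero (hF : AnalyticOnNhd ℂ F (unitBall n)) (hz : z ∈ unitBall n)
    (hne : ∃ s ∈ sliceDomain L b z, slice L b F z s ≠ 0) :
    ∃ k, taylorNorm (slice L b F z) k ≠ 0 := by
  by_contra! h0
  obtain ⟨s, hs, hsne⟩ := hne
  have hana := (differentiableOn_slice (L := L) (b := b) hF).analyticOnNhd
    (isOpen_sliceDomain L b z)
  have hcoeff (k : ℕ) : iteratedDeriv k (slice L b F z) 0 = 0 := by
    simpa [taylorNorm, Nat.factorial_ne_zero] using h0 k
  have hseries := (hana 0 (zero_mem_sliceDomain hz)).hasFPowerSeriesAt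
  have hgerm : slice L b F z =ᶠ[𝓝 0] 0 := hseries.locally_zero_iff.2 (by
    ext k
    simp [hcoeff])
  exact hsne (hana.eqOn_zero_of_preconnected_of_eventuallyEq_zero
    (convex_sliceDomain L b z).isPreconnected (zero_mem_sliceDomain hz) hgerm hs)

end Slices

section BoundedIndex

variable {n : ℕ} {b : Cn n} {β : ℝ} {L : Cn n → ℝ} {F : Cn n → ℂ}

lemma IsOfBoundedIndex.exists_hasIndexLE_slice (hF : IsOfBoundedIndex L b F)
    (hL : ∀ z ∈ unitBall n, 0 ≤ L z) :
    ∃ N, ∀ z ∈ unitBall n, HasIndexLE N (slice L b F z) := by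
  obtain ⟨hFa, N, hN⟩ := hF
  refine ⟨N, fun z hz => ?_⟩
  obtain ⟨k, hk, hmax⟩ := Finset.exists_mem_eq_sup' Finset.nonempty_range_add_one
    fun k => normalizedDeriv L b F k z
  refine ⟨k, Nat.lt_succ_iff.1 (Finset.mem_range.1 hk), fun m => ?_⟩
  rw [taylorNorm_slice hFa hz (hL z hz), taylorNorm_slice hFa hz (hL z hz), ← hmax]
  exact hN m z hz

lemma subset_closure_setOf_ne_zero {E : Type*} [NormedAddCommGroup E] [NormedSpace ℂ E] {U : Set E}
    {G : E → ℂ} (hU : IsOpen U) (hUc : IsPreconnected U) (hG : AnalyticOnNhd ℂ G U)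
    (hne : ∃ z ∈ U, G z ≠ 0) : U ⊆ closure {w ∈ U | G w ≠ 0} := by
  intro z hz
  by_contra hcon
  obtain ⟨w, hw, hGw⟩ := hne
  have hgerm : G =ᶠ[𝓝 z] 0 := by
    filter_upwards [isClosed_closure.isOpen_compl.mem_nhds hcon, hU.mem_nhds hz] with v hv hvU
    by_contra hGv
    exact hv (subset_closure ⟨hvU, hGv⟩)
  exact hGw (hG.eqOn_zero_of_preconnected_of_eventuallyEq_zero hUc hz hgerm hw)

namespace ClassQ

lemma continuousOn_normalizedDeriv (hL : ClassQ b β L) (hF : AnalyticOnNhd ℂ F (unitBall n))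
    (k : ℕ) : ContinuousOn (normalizedDeriv L b F k) (unitBall n) := by
  refine (analyticOnNhd_dirDeriv hF k).continuousOn.norm.div
    (continuousOn_const.mul (hL.continuousOn.pow k)) fun z hz => ?_
  have := hL.pos z hz
  positivity

lemma isOfBoundedIndex_of_hasIndexLE_slice (hL : ClassQ b β L)
    (hF : AnalyticOnNhd ℂ F (unitBall n)) {D : Set (Cn n)} (hD : D ⊆ unitBall n)
    (hdense : unitBall n ⊆ closure D) {N : ℕ} (h : ∀ z ∈ D, HasIndexLE N (slice L b F z)) :
    IsOfBoundedIndex L b F := by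
  refine ⟨hF, N, fun m z hz => ?_⟩
  have hcont (k : ℕ) := (hL.continuousOn_normalizedDeriv hF k z hz).mono hD
  refine ContinuousWithinAt.closure_le (hdense hz) (hcont m)
    (ContinuousWithinAt.finset_sup'_apply _ fun k _ => hcont k) fun w hw => ?_
  obtain ⟨k, hk, hmax⟩ := h w hw
  have hLw := (hL.pos w (hD hw)).le
  have hm := hmax m
  rw [taylorNorm_slice hF (hD hw) hLw, taylorNorm_slice hF (hD hw) hLw] at hm
  exact hm.trans (Finset.le_sup' (fun k => normalizedDeriv L b F k w)
    (Finset.mem_range.2 (Nat.lt_succ_of_le hk)))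

lemma closedBall_subset_sliceDomain (hL : ClassQ b β L) {z : Cn n} (hz : z ∈ unitBall n) :
    closedBall 0 β ⊆ sliceDomain L b z := by
  intro s hs
  have hLz := hL.pos z hz
  have hz1 : 0 < 1 - ‖z‖ := sub_pos.2 (mem_ball_zero_iff.1 hz)
  have hstep : ‖(s / (L z : ℂ)) • b‖ < 1 - ‖z‖ := by
    rw [norm_smul, norm_div, Complex.norm_real, Real.norm_of_nonneg hLz.le, div_mul_eq_mul_div,
      div_lt_iff₀ hLz, mul_comm (1 - ‖z‖)]
    calc ‖s‖ * ‖b‖ ≤ β * ‖b‖ := by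
          gcongr
          exact mem_closedBall_zero_iff.1 hs
      _ < L z * (1 - ‖z‖) := (div_lt_iff₀ hz1).1 (hL.lower_bound z hz)
  exact mem_ball_zero_iff.2 ((norm_add_le _ _).trans_lt (by linarith))

lemma differentiableOn_slice (hL : ClassQ b β L) (hF : AnalyticOnNhd ℂ F (unitBall n)) {z : Cn n}
    (hz : z ∈ unitBall n) : DifferentiableOn ℂ (slice L b F z) (ball 0 β) :=
  (LIndex.differentiableOn_slice hF).mono
    (ball_subset_closedBall.trans (hL.closedBall_subset_sliceDomain hz))

end ClassQ

/-- The constant `lam` compares the values of `L` at any two points of a line in direction `b` that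
are at distance at most `β` in the rescaled parameter. -/
structure IsComparisonConst (L : Cn n → ℝ) (b : Cn n) (β lam : ℝ) : Prop where
  one_le : 1 ≤ lam
  slicePoint_le : ∀ z ∈ unitBall n, ∀ s ∈ closedBall (0 : ℂ) β, L (slicePoint L b z s) ≤ lam * L z
  le_slicePoint : ∀ z ∈ unitBall n, ∀ s ∈ closedBall (0 : ℂ) β, L z ≤ lam * L (slicePoint L b z s)

namespace ClassQ

lemma ofReal_div_mem_Icc (hL : ClassQ b β L) {z : Cn n} (hz : z ∈ unitBall n) {s : ℂ}
    (hs : s ∈ closedBall (0 : ℂ) β) :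
    ENNReal.ofReal (L (slicePoint L b z s) / L z) ∈ Icc (lambda₁ L b β) (lambda₂ L b β) := by
  have h0 : (0 : ℂ) ∈ sliceParam b z := by simpa [sliceParam] using hz
  have ht : s / (L z : ℂ) ∈ closedBall (0 : ℂ) (β / L (z + (0 : ℂ) • b)) := by
    have hLz := hL.pos z hz
    rw [zero_smul, add_zero, mem_closedBall_zero_iff, norm_div, Complex.norm_real,
      Real.norm_of_nonneg hLz.le]
    gcongr
    exact mem_closedBall_zero_iff.1 hs
  have hat : ENNReal.ofReal (L (slicePoint L b z s) / L z) =
      ENNReal.ofReal (L (z + (s / (L z : ℂ)) • b) / L (z + (0 : ℂ) • b)) := by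
    rw [zero_smul, add_zero, slicePoint]
  rw [hat]
  exact ⟨(iInf₂_le z hz).trans ((iInf₂_le 0 h0).trans (iInf₂_le _ ht)),
    le_iSup₂_of_le z hz (le_iSup₂_of_le 0 h0 (le_iSup₂_of_le _ ht le_rfl))⟩

lemma exists_isComparisonConst (hL : ClassQ b β L) (hβ : 0 ≤ β) :
    ∃ lam, IsComparisonConst L b β lam := by
  obtain ⟨hpos, -, hfin⟩ := hL.lambda_bounds β ⟨hβ, le_rfl⟩
  set M₁ := (lambda₁ L b β)⁻¹.toReal
  set M₂ := (lambda₂ L b β).toReal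
  refine ⟨max 1 (max M₁ M₂), le_max_left _ _, fun z hz s hs => ?_, fun z hz s hs => ?_⟩
  · have h : L (slicePoint L b z s) / L z ≤ M₂ :=
      (ENNReal.ofReal_le_iff_le_toReal hfin.ne).1 (hL.ofReal_div_mem_Icc hz hs).2
    have hLz := hL.pos z hz
    rw [div_le_iff₀ hLz] at h
    exact h.trans (by gcongr; exact (le_max_right _ _).trans (le_max_right _ _))
  · have hLz := hL.pos z hz
    have hLw := hL.pos _ (hL.closedBall_subset_sliceDomain hz hs)
    have hinv : ENNReal.ofReal (L z / L (slicePoint L b z s)) ≤ (lambda₁ L b β)⁻¹ := by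
      rw [← inv_div, ENNReal.ofReal_inv_of_pos (by positivity)]
      exact ENNReal.inv_le_inv.2 (hL.ofReal_div_mem_Icc hz hs).1
    have h : L z / L (slicePoint L b z s) ≤ M₁ :=
      (ENNReal.ofReal_le_iff_le_toReal (ENNReal.inv_ne_top.2 hpos.ne')).1 hinv
    rw [div_le_iff₀ hLw] at h
    exact h.trans (by gcongr; exact (le_max_left _ _).trans (le_max_right _ _))

end ClassQ

end BoundedIndex

section Zeros

variable {n : ℕ} {b z : Cn n} {β lam ε : ℝ} {L : Cn n → ℝ} {F : Cn n → ℂ}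

/-- The zeros of `F` in the disc of radius `β` of the rescaled line through `z`. The set is empty by
convention if `F` vanishes on the whole line, so that it is always finite. -/
def sliceZeros (L : Cn n → ℝ) (b : Cn n) (F : Cn n → ℂ) (β : ℝ) (z : Cn n) : Set ℂ :=
  {a ∈ closedBall 0 β | slice L b F z a = 0 ∧ ∃ s ∈ sliceDomain L b z, slice L b F z s ≠ 0}

lemma slicePoint_slicePoint_sub (b : Cn n) {s : ℂ} (hz : L z ≠ 0) (hw : L (slicePoint L b z s) ≠ 0)
    (a : ℂ) : slicePoint L b (slicePoint L b z s) ((a - s) * (L (slicePoint L b z s) / L z : ℝ)) =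
      slicePoint L b z a := by
  rw [slicePoint_slicePoint b hz, mul_assoc, ← Complex.ofReal_mul, div_mul_div_cancel₀ hz,
    div_self hw, Complex.ofReal_one, mul_one, add_sub_cancel]

lemma encard_sliceZeros_inter_closedBall_le (hL : ClassQ b β L) (hβ : 1 ≤ β)
    (hlam : IsComparisonConst L b β lam) (hF : AnalyticOnNhd ℂ F (unitBall n)) {N : ℕ}
    (hN : ∀ z ∈ unitBall n, HasIndexLE N (slice L b F z)) (hz : z ∈ unitBall n) {x : ℂ}
    (hx : x ∈ closedBall (0 : ℂ) β) :
    (sliceZeros L b F β z ∩ closedBall x (1 / (10 * lam))).encard ≤ (4 * N + 1 : ℕ) := by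
  rcases (sliceZeros L b F β z).eq_empty_or_nonempty with hempty | ⟨-, -, -, s, hs, hFs⟩
  · simp [hempty]
  have hw := hL.closedBall_subset_sliceDomain hz hx
  have hLz := hL.pos z hz
  have hLw := hL.pos _ hw
  have hrebase := slicePoint_slicePoint_sub b hLz.ne' hLw.ne'
  set w := slicePoint L b z x
  have hlam0 : 0 < lam := zero_lt_one.trans_le hlam.one_le
  have hne : ∃ k, taylorNorm (slice L b F w) k ≠ 0 :=
    exists_taylorNorm_slice_ne_zero hF hw ⟨(s - x) * (L w / L z : ℝ),
      by rwa [sliceDomain, mem_preimage, hrebase], by rwa [slice, hrebase]⟩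
  refine (encard_le_encard_of_injOn (f := fun a => (a - x) * (L w / L z : ℝ)) ?_ ?_).trans
    ((hN w hw).encard_zeros_le
      ((hL.differentiableOn_slice hF hw).mono (ball_subset_ball hβ)) hne)
  · rintro a ⟨⟨-, ha0, -⟩, hax⟩
    refine ⟨mem_closedBall_zero_iff.2 ?_, by rwa [slice, hrebase]⟩
    rw [norm_mul, Complex.norm_real, Real.norm_of_nonneg (by positivity), ← dist_eq_norm]
    calc dist a x * (L w / L z) ≤ 1 / (10 * lam) * lam := by
          gcongr
          · exact hax
          · exact (div_le_iff₀ hLz).2 (hlam.slicePoint_le z hz x hx)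
      _ = 1 / 10 := by field_simp
  · have hratio : ((L w / L z : ℝ) : ℂ) ≠ 0 := Complex.ofReal_ne_zero.2 (by positivity)
    exact fun a _ a' _ h => sub_left_injective (mul_right_cancel₀ hratio h)

lemma exists_encard_sliceZeros_le (hL : ClassQ b β L) (hβ : 1 ≤ β) (hF : IsOfBoundedIndex L b F) :
    ∃ N : ℕ, ∀ z ∈ unitBall n, (sliceZeros L b F β z).encard ≤ N := by
  obtain ⟨N, hN⟩ := hF.exists_hasIndexLE_slice fun z hz => (hL.pos z hz).le
  obtain ⟨lam, hlam⟩ := hL.exists_isComparisonConst (zero_le_one.trans hβ)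
  have hlam0 : 0 < lam := zero_lt_one.trans_le hlam.one_le
  obtain ⟨I, hI, hIfin, hcover⟩ := (isCompact_closedBall (0 : ℂ) β).finite_cover_balls
    (e := 1 / (10 * lam)) (by positivity)
  lift I to Finset ℂ using hIfin
  refine ⟨∑ _x ∈ I, (4 * N + 1), fun z hz => ?_⟩
  have hsub : sliceZeros L b F β z ⊆
      ⋃ x ∈ I, sliceZeros L b F β z ∩ closedBall x (1 / (10 * lam)) := by
    intro a ha
    obtain ⟨x, hx, hax⟩ := mem_iUnion₂.1 (hcover ha.1)
    exact mem_iUnion₂.2 ⟨x, hx, ha, ball_subset_closedBall hax⟩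
  calc (sliceZeros L b F β z).encard
      ≤ ∑ x ∈ I, (sliceZeros L b F β z ∩ closedBall x (1 / (10 * lam))).encard :=
        (encard_le_encard hsub).trans (I.set_encard_biUnion_le _)
    _ ≤ ∑ _x ∈ I, ((4 * N + 1 : ℕ) : ℕ∞) := Finset.sum_le_sum fun x hx =>
        encard_sliceZeros_inter_closedBall_le hL hβ hlam hF.1 hN hz (hI hx)
    _ = (∑ _x ∈ I, (4 * N + 1) : ℕ) := (Nat.cast_sum _ _).symm

lemma slice_ne_zero_of_forall_lt {s : ℂ} (hs : ‖s‖ ≤ β - ε)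
    (hne : ∃ s ∈ sliceDomain L b z, slice L b F z s ≠ 0)
    (hfar : ∀ a ∈ sliceZeros L b F β z, ε < ‖s - a‖) {a : ℂ} (ha : ‖s - a‖ ≤ ε) :
    slice L b F z a ≠ 0 := fun h0 =>
  have haβ : ‖a‖ ≤ β := by
    have := norm_le_norm_add_norm_sub s a
    linarith
  (hfar a ⟨mem_closedBall_zero_iff.2 haβ, h0, hne⟩).not_ge ha

lemma slice_slicePoint_ne_zero (hL : ClassQ b β L) (hlam : IsComparisonConst L b β lam)
    (hz : z ∈ unitBall n) {s : ℂ} (hs : s ∈ closedBall (0 : ℂ) β)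
    (hne : ∀ a, ‖s - a‖ ≤ ε → slice L b F z a ≠ 0) {σ : ℂ} (hσ : ‖σ‖ ≤ ε / lam) :
    slice L b F (slicePoint L b z s) σ ≠ 0 := by
  have hLz := hL.pos z hz
  have hLw := hL.pos _ (hL.closedBall_subset_sliceDomain hz hs)
  have hlam0 : 0 < lam := zero_lt_one.trans_le hlam.one_le
  rw [slice, slicePoint_slicePoint b hLz.ne']
  refine hne _ ?_
  rw [sub_add_cancel_left, norm_neg, norm_mul, Complex.norm_real,
    Real.norm_of_nonneg (by positivity)]
  calc ‖σ‖ * (L z / L (slicePoint L b z s)) ≤ ε / lam * lam :=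
        mul_le_mul hσ ((div_le_iff₀ hLw).2 (hlam.le_slicePoint z hz s hs)) (by positivity)
          ((norm_nonneg σ).trans hσ)
    _ = ε := div_mul_cancel₀ _ hlam0.ne'

lemma notMem_zeroNhd (hL : ClassQ b β L) (hlam : IsComparisonConst L b β lam) {r : ℝ} (hr : 0 ≤ r)
    (hrβ : r ≤ β) {w : Cn n} (hw : w ∈ unitBall n)
    (hne : ∀ s, ‖s‖ ≤ r * lam → slice L b F w s ≠ 0) : w ∉ zeroNhd L b F r := by
  have hlam0 : 0 < lam := zero_lt_one.trans_le hlam.one_le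
  have hLw := hL.pos w hw
  intro hmem
  obtain ⟨z, -, ⟨hF0, t, ht, rfl⟩ | ⟨-, a, ha, hFa, t, hta, rfl⟩⟩ := mem_iUnion₂.1 hmem
  · exact hne 0 (by rw [norm_zero]; positivity) (by rw [slice_zero]; exact hF0 t ht)
  · set x := z + a • b with hx
    have hLx := hL.pos x ha
    rw [le_div_iff₀ hLx] at hta
    have hparam : z + t • b = slicePoint L b x ((t - a) * L x) := by
      rw [slicePoint_mul b hLx.ne', hx, add_assoc, ← add_smul, add_sub_cancel]
    have hnorm : ‖(t - a) * (L x : ℂ)‖ ≤ r := by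
      rwa [norm_mul, Complex.norm_real, Real.norm_of_nonneg hLx.le]
    have hcomp : L (z + t • b) ≤ lam * L x := by
      rw [hparam]
      exact hlam.slicePoint_le x ha _ (mem_closedBall_zero_iff.2 (hnorm.trans hrβ))
    refine hne ((a - t) * L (z + t • b)) ?_ ?_
    · rw [norm_mul, Complex.norm_real, Real.norm_of_nonneg hLw.le, norm_sub_rev]
      calc ‖t - a‖ * L (z + t • b) ≤ ‖t - a‖ * (lam * L x) := by gcongr
        _ = ‖t - a‖ * L x * lam := by ring
        _ ≤ r * lam := by gcongr
    · rwa [slice, slicePoint_mul b hLw.ne', add_assoc, ← add_smul, add_sub_cancel]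

lemma IsComparisonConst.div_div_le (hlam : IsComparisonConst L b β lam) (hε : ε ∈ Icc 0 β) :
    ε / lam / lam ≤ β := by
  rw [div_div]
  exact (div_le_self hε.1 (one_le_mul_of_one_le_of_one_le hlam.one_le hlam.one_le)).trans hε.2

lemma notMem_zeroNhd_slicePoint (hL : ClassQ b β L) (hlam : IsComparisonConst L b β lam)
    (hε : ε ∈ Icc 0 β) (hz : z ∈ unitBall n) {s : ℂ} (hs : s ∈ closedBall (0 : ℂ) β)
    (hne : ∀ a, ‖s - a‖ ≤ ε → slice L b F z a ≠ 0) :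
    slicePoint L b z s ∉ zeroNhd L b F (ε / lam / lam) := by
  have hlam0 : 0 < lam := zero_lt_one.trans_le hlam.one_le
  have hε0 : 0 ≤ ε := hε.1
  refine notMem_zeroNhd hL hlam (by positivity) (hlam.div_div_le hε)
    (hL.closedBall_subset_sliceDomain hz hs)
    fun σ hσ => slice_slicePoint_ne_zero hL hlam hz hs hne ?_
  rwa [div_mul_cancel₀ _ hlam0.ne'] at hσ

lemma norm_deriv_slice_le (hL : ClassQ b β L) (hβ : 1 ≤ β) (hlam : IsComparisonConst L b β lam)
    (hF : AnalyticOnNhd ℂ F (unitBall n)) {N : ℕ}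
    (hN : ∀ z ∈ unitBall n, HasIndexLE N (slice L b F z)) (hz : z ∈ unitBall n) {s : ℂ}
    (hs : s ∈ closedBall (0 : ℂ) β) {ρ : ℝ} (hρ : 0 < ρ) (hρ2 : ρ ≤ 1 / 2) (hρε : ρ ≤ ε / lam)
    (hne : ∀ a, ‖s - a‖ ≤ ε → slice L b F z a ≠ 0) :
    ‖deriv (slice L b F z) s‖ ≤ 4 * (4 / ρ) ^ (3 * N) * lam * ‖slice L b F z s‖ := by
  have hw := hL.closedBall_subset_sliceDomain hz hs
  have hLz := hL.pos z hz
  have hLw := hL.pos _ hw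
  have hcomp := hlam.slicePoint_le z hz s hs
  set w := slicePoint L b z s
  have hcenter : ‖dirDeriv b 1 F w‖ / L w ≤ 4 * (4 / ρ) ^ (3 * N) * ‖F w‖ := by
    have h1 := (hN w hw).taylorNorm_le
      ((hL.differentiableOn_slice hF hw).mono (ball_subset_ball hβ)) hρ hρ2
      (fun σ hσ => slice_slicePoint_ne_zero hL hlam hz hs hne
        ((mem_ball_zero_iff.1 hσ).le.trans hρε)) 1
    rwa [taylorNorm_slice hF hw hLw.le, slice_zero, normalizedDeriv, Nat.factorial_one,
      Nat.cast_one, one_mul, pow_one] at h1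
  have hderiv : deriv (slice L b F z) s = dirDeriv b 1 F w / L z :=
    (hasDerivAt_dirDeriv_slice hF 0 hw).deriv
  rw [hderiv, norm_div, Complex.norm_real,
    Real.norm_of_nonneg hLz.le, div_le_iff₀ hLz]
  calc ‖dirDeriv b 1 F w‖ ≤ 4 * (4 / ρ) ^ (3 * N) * ‖F w‖ * L w := (div_le_iff₀ hLw).1 hcenter
    _ ≤ 4 * (4 / ρ) ^ (3 * N) * ‖F w‖ * (lam * L z) := by gcongr
    _ = 4 * (4 / ρ) ^ (3 * N) * lam * ‖F w‖ * L z := by ring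

lemma exists_norm_deriv_slice_le (hL : ClassQ b β L) (hβ : 1 ≤ β) (hF : IsOfBoundedIndex L b F)
    (hε : 0 < ε) : ∃ K, 0 ≤ K ∧ ∀ z ∈ unitBall n, ∀ s : ℂ, ‖s‖ ≤ β - ε →
      (∀ a ∈ sliceZeros L b F β z, ε < ‖s - a‖) →
        ‖deriv (slice L b F z) s‖ ≤ K * ‖slice L b F z s‖ := by
  obtain ⟨N, hN⟩ := hF.exists_hasIndexLE_slice fun z hz => (hL.pos z hz).le
  obtain ⟨lam, hlam⟩ := hL.exists_isComparisonConst (zero_le_one.trans hβ)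
  have hlam0 : 0 < lam := zero_lt_one.trans_le hlam.one_le
  have hρ : 0 < min (1 / 2) (ε / lam) := lt_min (by norm_num) (by positivity)
  refine ⟨4 * (4 / min (1 / 2) (ε / lam)) ^ (3 * N) * lam, by positivity, fun z hz s hs hfar => ?_⟩
  have hsβ : s ∈ closedBall (0 : ℂ) β := mem_closedBall_zero_iff.2 (by linarith)
  by_cases hne : ∃ s ∈ sliceDomain L b z, slice L b F z s ≠ 0
  · exact norm_deriv_slice_le hL hβ hlam hF.1 hN hz hsβ hρ (min_le_left _ _) (min_le_right _ _)
      fun a => slice_ne_zero_of_forall_lt hs hne hfar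
  · push Not at hne
    have hgerm : slice L b F z =ᶠ[𝓝 s] fun _ => 0 := eventuallyEq_of_mem
      ((isOpen_sliceDomain L b z).mem_nhds (hL.closedBall_subset_sliceDomain hz hsβ)) hne
    rw [hgerm.deriv_eq, deriv_const, norm_zero]
    positivity

end Zeros

section Equation

lemma norm_deriv_div_le {u v : ℂ → ℂ} {s : ℂ} {K₁ K₂ : ℝ} (hu : DifferentiableAt ℂ u s)
    (hv : DifferentiableAt ℂ v s) (hv0 : v s ≠ 0) (hu' : ‖deriv u s‖ ≤ K₁ * ‖u s‖)
    (hv' : ‖deriv v s‖ ≤ K₂ * ‖v s‖) :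
    ‖deriv (fun s => u s / v s) s‖ ≤ (K₁ + K₂) * ‖u s / v s‖ := by
  have : 0 < ‖v s‖ := norm_pos_iff.2 hv0
  rw [(hu.hasDerivAt.fun_div hv.hasDerivAt hv0).deriv, norm_div, norm_div, norm_pow,
    div_le_iff₀ (by positivity)]
  calc ‖deriv u s * v s - u s * deriv v s‖ ≤ ‖deriv u s‖ * ‖v s‖ + ‖u s‖ * ‖deriv v s‖ := by
        simpa only [norm_mul] using norm_sub_le (deriv u s * v s) (u s * deriv v s)
    _ ≤ K₁ * ‖u s‖ * ‖v s‖ + ‖u s‖ * (K₂ * ‖v s‖) := by gcongr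
    _ = (K₁ + K₂) * (‖u s‖ / ‖v s‖) * ‖v s‖ ^ 2 := by field_simp

lemma norm_sum_succ_mul_le {p : ℕ} {c : Fin (p + 1) → ℂ} {B : ℝ} (hc : ∀ j : Fin p, ‖c j.succ‖ ≤ B)
    (d : ℕ → ℂ) :
    ‖∑ j : Fin p, c j.succ * d (p - (j + 1))‖ ≤ B * ∑ k ∈ Finset.range p, ‖d k‖ := by
  rw [← Finset.sum_range_reflect, ← Fin.sum_univ_eq_sum_range (fun k => ‖d (p - 1 - k)‖),
    Finset.mul_sum]
  refine norm_sum_le_of_le _ fun j _ => ?_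
  rw [norm_mul, Nat.sub_sub, add_comm 1]
  exact mul_le_mul_of_nonneg_right (hc j) (norm_nonneg _)

lemma JetBound.of_equation {p : ℕ} {C K₁ K₂ : ℝ} {f u v : ℂ → ℂ} {s : ℂ} (hC : 1 ≤ C)
    (hK : K₁ + K₂ ≤ C) (hu : DifferentiableAt ℂ u s) (hv : DifferentiableAt ℂ v s) (hv0 : v s ≠ 0)
    (hu' : ‖deriv u s‖ ≤ K₁ * ‖u s‖) (hv' : ‖deriv v s‖ ≤ K₂ * ‖v s‖) {c : Fin (p + 1) → ℂ}
    (hc0 : c 0 = v s) (hc : ∀ j : Fin p, ‖c j.succ‖ ≤ C * ‖v s‖)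
    (heq : ∑ j : Fin (p + 1), c j * iteratedDeriv (p - j) f s = u s) :
    JetBound p C f (fun s => u s / v s) s := by
  set S := ∑ k ∈ Finset.range p, ‖iteratedDeriv k f s‖ with hS
  set R := ∑ j : Fin p, c j.succ * iteratedDeriv (p - (j + 1)) f s
  have hR : ‖R / v s‖ ≤ C * S := by
    rw [norm_div, div_le_iff₀ (norm_pos_iff.2 hv0), mul_right_comm]
    exact norm_sum_succ_mul_le hc fun k => iteratedDeriv k f s
  have hmonic : u s / v s = iteratedDeriv p f s + R / v s := by
    simp only [Fin.sum_univ_succ, hc0, Fin.val_zero, Nat.sub_zero, Fin.val_succ] at heq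
    rw [← heq, add_div, mul_div_cancel_left₀ _ hv0]
  refine ⟨hu.div hv hv0, (norm_deriv_div_le hu hv hv0 hu' hv').trans (by gcongr), ?_, ?_⟩
  · calc ‖iteratedDeriv p f s‖ = ‖u s / v s - R / v s‖ := by rw [hmonic, add_sub_cancel_right]
      _ ≤ ‖u s / v s‖ + C * S := (norm_sub_le _ _).trans (by gcongr)
  · calc ‖u s / v s‖ ≤ ‖iteratedDeriv p f s‖ + ‖R / v s‖ := hmonic ▸ norm_add_le _ _
      _ ≤ C * ‖iteratedDeriv p f s‖ + C * S := by
          gcongr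
          exact le_mul_of_one_le_left (norm_nonneg _) hC
      _ = C * ∑ k ∈ Finset.range (p + 1), ‖iteratedDeriv k f s‖ := by
          rw [Finset.sum_range_succ, ← hS]; ring

variable {n : ℕ} {b z : Cn n} {β lam : ℝ} {L : Cn n → ℝ} {p : ℕ}
  {g : Fin (p + 1) → Cn n → ℂ} {h F : Cn n → ℂ}

lemma sum_slice_div_mul_iteratedDeriv_eq (hF : AnalyticOnNhd ℂ F (unitBall n))
    (heq : ∀ z ∈ unitBall n, ∑ j : Fin (p + 1), g j z * dirDeriv b (p - (j : ℕ)) F z = h z) {s : ℂ}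
    (hs : s ∈ sliceDomain L b z) :
    ∑ j : Fin (p + 1), slice L b (g j) z s / (L z : ℂ) ^ (j : ℕ) *
      iteratedDeriv (p - (j : ℕ)) (slice L b F z) s = slice L b h z s / (L z : ℂ) ^ p := by
  rw [slice, ← heq _ hs, Finset.sum_div]
  refine Finset.sum_congr rfl fun j _ => ?_
  have hp : (L z : ℂ) ^ p = (L z : ℂ) ^ (j : ℕ) * (L z : ℂ) ^ (p - (j : ℕ)) := by
    rw [← pow_add, Nat.add_sub_cancel' (Nat.lt_succ_iff.1 j.2)]
  rw [iteratedDeriv_slice hF _ hs, hp, div_mul_div_comm, slice, slice]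

lemma norm_slice_div_pow_le (hL : ClassQ b β L) (hlam : IsComparisonConst L b β lam)
    (hz : z ∈ unitBall n) {s : ℂ} (hs : s ∈ closedBall (0 : ℂ) β) {G G₀ : Cn n → ℂ} {T : ℝ}
    (hT : 0 ≤ T) {j : ℕ} (hj : j ≤ p)
    (hG : ‖slice L b G z s‖ ≤ T * L (slicePoint L b z s) ^ j * ‖slice L b G₀ z s‖) :
    ‖slice L b G z s / (L z : ℂ) ^ j‖ ≤ T * lam ^ p * ‖slice L b G₀ z s‖ := by
  have hLz := hL.pos z hz
  have hLw := hL.pos _ (hL.closedBall_subset_sliceDomain hz hs)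
  rw [norm_div, norm_pow, Complex.norm_real, Real.norm_of_nonneg hLz.le,
    div_le_iff₀ (by positivity)]
  calc ‖slice L b G z s‖ ≤ T * L (slicePoint L b z s) ^ j * ‖slice L b G₀ z s‖ := hG
    _ ≤ T * (lam * L z) ^ j * ‖slice L b G₀ z s‖ := by
        gcongr
        exact hlam.slicePoint_le z hz s hs
    _ = T * lam ^ j * ‖slice L b G₀ z s‖ * L z ^ j := by ring
    _ ≤ T * lam ^ p * ‖slice L b G₀ z s‖ * L z ^ j := by
        gcongr
        exact hlam.one_le

lemma exists_jetBound_slice (hβ : 1 ≤ β) (hL : ClassQ b β L) (hg0 : IsOfBoundedIndex L b (g 0))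
    (hh : IsOfBoundedIndex L b h)
    (hT : ∀ r : ℝ, 0 < r → r ≤ β → ∃ T : ℝ, 0 < T ∧ ∀ z ∈ unitBall n \ zeroNhd L b (g 0) r,
      ∀ j : Fin (p + 1), 1 ≤ (j : ℕ) → ‖g j z‖ ≤ T * L z ^ (j : ℕ) * ‖g 0 z‖)
    (hF : AnalyticOnNhd ℂ F (unitBall n))
    (heq : ∀ z ∈ unitBall n, ∑ j : Fin (p + 1), g j z * dirDeriv b (p - (j : ℕ)) F z = h z)
    {ε : ℝ} (hε : ε ∈ Ioc 0 β) :
    ∃ C, 1 ≤ C ∧ ∀ z ∈ unitBall n, g 0 z ≠ 0 → ∀ s : ℂ, ‖s‖ ≤ β - ε →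
      (∀ a ∈ sliceZeros L b (g 0) β z ∪ sliceZeros L b h β z, ε < ‖s - a‖) →
      JetBound p C (slice L b F z)
        (fun s => slice L b h z s / (L z : ℂ) ^ p / slice L b (g 0) z s) s := by
  have hε0 : 0 < ε := hε.1
  obtain ⟨lam, hlam⟩ := hL.exists_isComparisonConst (zero_le_one.trans hβ)
  have hlam0 : 0 < lam := zero_lt_one.trans_le hlam.one_le
  obtain ⟨T, hT0, hTle⟩ := hT (ε / lam / lam) (by positivity) (hlam.div_div_le ⟨hε0.le, hε.2⟩)
  obtain ⟨K₁, hK₁, hlog₁⟩ := exists_norm_deriv_slice_le hL hβ hh hε0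
  obtain ⟨K₂, hK₂, hlog₂⟩ := exists_norm_deriv_slice_le hL hβ hg0 hε0
  have hTlam : 0 < T * lam ^ p := by positivity
  refine ⟨1 + T * lam ^ p + K₁ + K₂, by linarith, fun z hz hgz s hs hfar => ?_⟩
  have hsβ : s ∈ closedBall (0 : ℂ) β := mem_closedBall_zero_iff.2 (by linarith)
  have hw := hL.closedBall_subset_sliceDomain hz hsβ
  have hdiff {G : Cn n → ℂ} (hG : AnalyticOnNhd ℂ G (unitBall n)) :
      DifferentiableAt ℂ (slice L b G z) s :=
    (differentiableOn_slice hG).differentiableAt ((isOpen_sliceDomain L b z).mem_nhds hw)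
  have hne : ∀ a, ‖s - a‖ ≤ ε → slice L b (g 0) z a ≠ 0 := fun a =>
    slice_ne_zero_of_forall_lt hs ⟨0, zero_mem_sliceDomain hz, by rwa [slice_zero]⟩
      fun a ha => hfar a (Or.inl ha)
  have hnot := notMem_zeroNhd_slicePoint hL hlam ⟨hε0.le, hε.2⟩ hz hsβ hne
  refine JetBound.of_equation (K₁ := K₁) (K₂ := K₂) (by linarith) (by linarith)
    ((hdiff hh.1).div_const _) (hdiff hg0.1) (hne s (by rw [sub_self, norm_zero]; exact hε0.le))
    ?_ (hlog₂ z hz s hs fun a ha => hfar a (Or.inl ha))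
    (c := fun j => slice L b (g j) z s / (L z : ℂ) ^ (j : ℕ)) (by simp) (fun j => ?_)
    (sum_slice_div_mul_iteratedDeriv_eq hF heq hw)
  · rw [deriv_div_const, norm_div, norm_div, ← mul_div_assoc]
    gcongr
    exact hlog₁ z hz s hs fun a ha => hfar a (Or.inr ha)
  · refine (norm_slice_div_pow_le hL hlam hz hsβ hT0.le (Nat.lt_succ_iff.1 j.succ.2)
      (hTle _ ⟨hw, hnot⟩ j.succ (by simp))).trans ?_
    gcongr
    linarith

end Equation

lemma exists_ne_zero_of_diff_zeroNhd_nonempty {n : ℕ} {L : Cn n → ℝ} {b : Cn n} {F : Cn n → ℂ}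
    {r : ℝ} (hne : (unitBall n \ zeroNhd L b F r).Nonempty) : ∃ z ∈ unitBall n, F z ≠ 0 := by
  by_contra! h0
  obtain ⟨w, hw, hwF⟩ := hne
  have h0w : (0 : ℂ) ∈ sliceParam b w := by simpa [sliceParam] using hw
  exact hwF (mem_iUnion₂.2 ⟨w, hw, Or.inl ⟨fun t ht => h0 _ ht, 0, h0w, by simp⟩⟩)

end LIndex

end

open LIndex Set in
theorem theorem13_general {n : ℕ} {b : Cn n} {β : ℝ} (hβ : 1 < β) {L : Cn n → ℝ}
    (hL : ClassQ b β L) {p : ℕ} {g : Fin (p + 1) → Cn n → ℂ} {h : Cn n → ℂ}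
    (hg0 : IsOfBoundedIndex L b (g 0)) (hh : IsOfBoundedIndex L b h)
    (hg0ne : ∃ z ∈ unitBall n, g 0 z ≠ 0)
    (hT : ∀ r : ℝ, 0 < r → r ≤ β → ∃ T : ℝ, 0 < T ∧ ∀ z ∈ unitBall n \ zeroNhd L b (g 0) r,
      ∀ j : Fin (p + 1), 1 ≤ (j : ℕ) → ‖g j z‖ ≤ T * L z ^ (j : ℕ) * ‖g 0 z‖)
    {F : Cn n → ℂ} (hF : AnalyticOnNhd ℂ F (unitBall n))
    (heq : ∀ z ∈ unitBall n, ∑ j : Fin (p + 1), g j z * dirDeriv b (p - (j : ℕ)) F z = h z) :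
    IsOfBoundedIndex L b F := by
  obtain ⟨N₁, hN₁⟩ := exists_encard_sliceZeros_le hL hβ.le hg0
  obtain ⟨N₂, hN₂⟩ := exists_encard_sliceZeros_le hL hβ.le hh
  obtain ⟨ε, hε, hindex⟩ := exists_hasIndexLE_of_jetBound hβ (N₁ + N₂)
  obtain ⟨C, hC, hjet⟩ := exists_jetBound_slice hβ.le hL hg0 hh hT hF heq hε
  obtain ⟨m₀, hm₀⟩ := hindex p C hC
  have hdense : unitBall n ⊆ closure {w ∈ unitBall n | g 0 w ≠ 0} :=
    subset_closure_setOf_ne_zero Metric.isOpen_ball (convex_ball 0 1).isPreconnected hg0.1 hg0ne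
  refine hL.isOfBoundedIndex_of_hasIndexLE_slice hF (sep_subset _ _) hdense (N := m₀) fun z hz => ?_
  have hcard : (sliceZeros L b (g 0) β z ∪ sliceZeros L b h β z).encard ≤ (N₁ + N₂ : ℕ) := by
    rw [Nat.cast_add]
    exact (encard_union_le _ _).trans (add_le_add (hN₁ z hz.1) (hN₂ z hz.1))
  exact hm₀ _ _ _ (hL.differentiableOn_slice hF hz.1) hcard (hjet z hz.1 hz.2)

theorem theorem13 (n : ℕ) (b : LIndex.Cn n) (hb : b ≠ 0) (β : ℝ) (hβ : 1 < β)
    (L : LIndex.Cn n → ℝ) (hL : LIndex.ClassQ b β L)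
    (p : ℕ) (g : Fin (p + 1) → LIndex.Cn n → ℂ) (h : LIndex.Cn n → ℂ)
    (hg : ∀ j, LIndex.IsOfBoundedIndex L b (g j))
    (hh : LIndex.IsOfBoundedIndex L b h)
    (hne : (LIndex.unitBall n \ LIndex.zeroNhd L b (g 0) β).Nonempty)
    (hT : ∀ r : ℝ, 0 < r → r ≤ β → ∃ T : ℝ, 0 < T ∧
      ∀ z ∈ LIndex.unitBall n \ LIndex.zeroNhd L b (g 0) r,
        ∀ j : Fin (p + 1), 1 ≤ (j : ℕ) → ‖g j z‖ ≤ T * L z ^ (j : ℕ) * ‖g 0 z‖)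
    (F : LIndex.Cn n → ℂ) (hF : AnalyticOnNhd ℂ F (LIndex.unitBall n))
    (heq : ∀ z ∈ LIndex.unitBall n,
      ∑ j : Fin (p + 1), g j z * LIndex.dirDeriv b (p - (j : ℕ)) F z = h z) :
    LIndex.IsOfBoundedIndex L b F :=
  theorem13_general hβ hL (hg 0) hh (LIndex.exists_ne_zero_of_diff_zeroNhd_nonempty hne) hT hF heq
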